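/- Let $k$ be an algebraically closed field of characteristic zero. A *tensor category* over $k$ is a $k$-linear abelian rigid monoidal category with $k$-bilinear tensor product, finite-dimensional Hom spaces, all objects of finite length, and simple unit object $\mathbf 1$; a *tensor functor* is a $k$-linear exact strong monoidal functor. An object is *trivial* if it is isomorphic to $\mathbf 1^n$ for some $n\ge 0$. Let $\mathcal C'\xrightarrow{f}\mathcal C\xrightarrow{F}\mathcal C''$ be an exact sequence of tensor categories over $k$, that is, $f$ and $F$ are tensor functors such that: $F$ is dominant (every object of $\mathcal C''$ is a subobject of some $F(X)$); $F$ is normal (every object $X$ of $\mathcal C$ has a subobject $X_0$ such that $F(X_0)$ is the largest trivial subobject of $F(X)$); and $f$ is fully faithful with essential image the objects $X$ of $\mathcal C$ such that $F(X)$ is trivial. Assume the sequence is perfect, that is, $F$ has an exact right adjoint $R$. Let $\mathcal A=(A,\sigma)$ be the induced central algebra: $A=R(\mathbf 1)$ with the algebra structure given by the lax monoidal structure of $R$, and with the half-braiding $\sigma_X\colon A\otimes X\to X\otimes A$ which is the composite of the canonical isomorphisms $R(\mathbf 1)\otimes X\cong R(F(X))\cong X\otimes R(\mathbf 1)$; it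 is an algebra in the Drinfeld center $\mathcal Z(\mathcal C)$, whose braiding is $c_{(Z,c),(Z',c')}=c_{Z'}$. Let $H$ be the induced Hopf algebra, the coend of the monoidal functor $\omega=\operatorname{Hom}_{\mathcal C''}(\mathbf 1,Ff(-))$ from $\mathcal C'$ to finite-dimensional vector spaces. Then the following are equivalent: (i) $\mathcal A$ is a symmetric object of $\mathcal Z(\mathcal C)$, that is, $c_{\mathcal A,\mathcal A}^2=\operatorname{id}_{\mathcal A\otimes\mathcal A}$; (ii) the free right $\mathcal A$-module $\mathcal A\otimes\mathcal A$, with action $\mu=\operatorname{id}\otimes m$ where $m$ is the multiplication of $\mathcal A$, is dyslectic in $\mathcal Z(\mathcal C)$, that is, $\mu\, c_{\mathcal A,\mathcal A\otimes\mathcal A}\, c_{\mathcal A\otimes\mathcal A,\mathcal A}=\mu$; (iii) the sequence is abelian, that is, $H$ is finite dimensional and commutative. -/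

import Mathlib

open CategoryTheory MonoidalCategory Limits
open scoped TensorProduct DirectSum

universe w v u v₁ u₁ v₂ u₂ v₃ u₃

namespace TensorCat

section Braided

variable {B : Type u} [Category.{v} B] [MonoidalCategory B]

/-- A right module over an algebra `A` in a monoidal category. -/
structure RightModule (A : B) [MonObj A] where
  obj : B
  act : obj ⊗ A ⟶ obj
  act_one : obj ◁ MonObj.one ≫ act = (ρ_ obj).hom
  act_mul : act ▷ A ≫ act = (α_ obj A A).hom ≫ obj ◁ MonObj.mul ≫ act

/-- The free right `A`-module `X ⊗ A`, with action induced by the multiplication of `A`. -/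
def freeRightModule (A : B) [MonObj A] (X : B) : RightModule A where
  obj := X ⊗ A
  act := (α_ X A A).hom ≫ X ◁ MonObj.mul
  act_one := by
    rw [tensor_whiskerLeft, Category.assoc, Category.assoc, Iso.inv_hom_id_assoc,
      ← MonoidalCategory.whiskerLeft_comp, MonObj.mul_one, ← rightUnitor_tensor_hom]
  act_mul := by
    have h := MonObj.mul_assoc A
    have h' := congrArg (fun t => X ◁ t) h
    simp only [MonoidalCategory.whiskerLeft_comp] at h'
    simp only [comp_whiskerRight, Category.assoc, tensor_whiskerLeft, whisker_assoc,
      Iso.inv_hom_id_assoc, h']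
    rw [pentagon_assoc]

variable [BraidedCategory B]

/-- An object `X` of a braided category is symmetric if `c_{X,X}² = id`. -/
def IsSymmetricObject (X : B) : Prop := (β_ X X).hom ≫ (β_ X X).hom = 𝟙 (X ⊗ X)

/-- A right `A`-module `μ : X ⊗ A ⟶ X` in a braided category is dyslectic if
`μ ∘ c_{A,X} ∘ c_{X,A} = μ`. -/
def RightModule.IsDyslectic {A : B} [MonObj A] (M : RightModule A) : Prop :=
  (β_ M.obj A).hom ≫ (β_ A M.obj).hom ≫ M.act = M.act

end Braided

section Proj
variable {C : Type u₁} [Category.{v₁} C] [MonoidalCategory C]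
  {D : Type u₂} [Category.{v₂} D] [MonoidalCategory D]
open Functor.LaxMonoidal Functor.OplaxMonoidal Functor.Monoidal ExactPairing

/-- A monoidal functor maps dual pairs to dual pairs. -/
@[reducible] def mapPairing (F : C ⥤ D) [F.Monoidal] (X Y : C) [ExactPairing X Y] :
    ExactPairing (F.obj X) (F.obj Y) where
  coevaluation' := ε F ≫ F.map (coevaluation X Y) ≫ δ F X Y
  evaluation' := μ F Y X ≫ F.map (evaluation X Y) ≫ η F
  coevaluation_evaluation' := by
    have h := congrArg (fun t => F.obj Y ◁ ε F ≫ μ F Y (𝟙_ C) ≫ F.map t ≫ δ F (𝟙_ C) Y ≫ η F ▷ F.obj Y)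
      (coevaluation_evaluation X Y)
    simp only [Functor.map_comp, Functor.Monoidal.map_whiskerLeft, Functor.Monoidal.map_whiskerRight,
      Functor.Monoidal.map_associator_inv, Functor.Monoidal.map_rightUnitor,
      Functor.Monoidal.map_leftUnitor_inv] at h
    simp only [Category.assoc, μ_δ_assoc] at h
    simp only [MonoidalCategory.whiskerLeft_comp, comp_whiskerRight, Category.assoc]
    rw [h]
    simp
  evaluation_coevaluation' := by
    have h := congrArg (fun t => ε F ▷ F.obj X ≫ μ F (𝟙_ C) X ≫ F.map t ≫ δ F X (𝟙_ C) ≫ F.obj X ◁ η F)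
      (evaluation_coevaluation X Y)
    simp only [Functor.map_comp, Functor.Monoidal.map_whiskerLeft, Functor.Monoidal.map_whiskerRight,
      Functor.Monoidal.map_associator, Functor.Monoidal.map_rightUnitor_inv,
      Functor.Monoidal.map_leftUnitor] at h
    simp only [Category.assoc, μ_δ_assoc] at h
    simp only [MonoidalCategory.whiskerLeft_comp, comp_whiskerRight, Category.assoc]
    rw [h]
    simp

variable {F : C ⥤ D} [F.Monoidal] {R : D ⥤ C} (adj : F ⊣ R)

/-- The component `F (R 𝟙) ⟶ 𝟙` of the counit. -/
def counitUnit : F.obj (R.obj (𝟙_ D)) ⟶ 𝟙_ D := adj.counit.app (𝟙_ D)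

/-- The morphism `F (X ⊗ R 𝟙) ⟶ F X` induced by the counit `F (R 𝟙) ⟶ 𝟙`. -/
def projL (X : C) : F.obj (X ⊗ R.obj (𝟙_ D)) ⟶ F.obj X :=
  δ F X (R.obj (𝟙_ D)) ≫ F.obj X ◁ counitUnit adj ≫ (ρ_ (F.obj X)).hom

/-- The morphism `F (R 𝟙 ⊗ X) ⟶ F X` induced by the counit `F (R 𝟙) ⟶ 𝟙`. -/
def projR (X : C) : F.obj (R.obj (𝟙_ D) ⊗ X) ⟶ F.obj X :=
  δ F (R.obj (𝟙_ D)) X ≫ counitUnit adj ▷ F.obj X ≫ (λ_ (F.obj X)).hom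

/-- The canonical morphism `X ⊗ R 𝟙 ⟶ R (F X)`, adjoint to `projL`. -/
def hopfL (X : C) : X ⊗ R.obj (𝟙_ D) ⟶ R.obj (F.obj X) := adj.homEquiv _ _ (projL adj X)

/-- The canonical morphism `R 𝟙 ⊗ X ⟶ R (F X)`, adjoint to `projR`. -/
def hopfR (X : C) : R.obj (𝟙_ D) ⊗ X ⟶ R.obj (F.obj X) := adj.homEquiv _ _ (projR adj X)

lemma projL_naturality {X Y : C} (f : X ⟶ Y) :
    F.map (f ▷ R.obj (𝟙_ D)) ≫ projL adj Y = projL adj X ≫ F.map f := by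
  simp only [projL, Functor.Monoidal.map_whiskerRight, Category.assoc, μ_δ_assoc]
  rw [← whisker_exchange_assoc]
  simp

lemma projR_naturality {X Y : C} (f : X ⟶ Y) :
    F.map (R.obj (𝟙_ D) ◁ f) ≫ projR adj Y = projR adj X ≫ F.map f := by
  simp only [projR, Functor.Monoidal.map_whiskerLeft, Category.assoc, μ_δ_assoc]
  rw [whisker_exchange_assoc]
  simp

lemma projL_tensor (X Y : C) :
    F.map (α_ X Y (R.obj (𝟙_ D))).hom ≫ δ F X (Y ⊗ R.obj (𝟙_ D)) ≫
      F.obj X ◁ projL adj Y = projL adj (X ⊗ Y) ≫ δ F X Y := by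
  simp only [projL, Functor.Monoidal.map_associator, Category.assoc, μ_δ_assoc,
    whiskerLeft_μ_δ_assoc, MonoidalCategory.whiskerLeft_comp]
  rw [← rightUnitor_naturality, whisker_exchange_assoc, rightUnitor_tensor_hom]
  simp only [tensor_whiskerLeft, Category.assoc,
    Iso.inv_hom_id_assoc]

lemma projR_tensor (X Y : C) :
    projR adj (X ⊗ Y) ≫ δ F X Y = F.map (α_ _ _ _).inv ≫ δ F _ Y ≫ projR adj X ▷ F.obj Y := by
  simp only [projR, Functor.Monoidal.map_associator_inv, Category.assoc, μ_δ_assoc,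
    comp_whiskerRight, whiskerRight_μ_δ_assoc]
  rw [← leftUnitor_naturality, ← whisker_exchange_assoc, leftUnitor_tensor_hom]
  simp only [whiskerRight_tensor, Category.assoc, Iso.hom_inv_id_assoc]

lemma projM_tensor (X Y : C) :
    F.map (α_ X (R.obj (𝟙_ D)) Y).hom ≫ δ F X (R.obj (𝟙_ D) ⊗ Y) ≫ F.obj X ◁ projR adj Y =
      δ F (X ⊗ R.obj (𝟙_ D)) Y ≫ projL adj X ▷ F.obj Y := by
  simp only [projR, projL, Functor.Monoidal.map_associator, Category.assoc, μ_δ_assoc,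
    comp_whiskerRight, MonoidalCategory.whiskerLeft_comp,
    whiskerLeft_μ_δ_assoc]
  simp only [whisker_assoc, Category.assoc, triangle_assoc_comp_right]


lemma bijective_projL (X Y : C) [ExactPairing X Y] (Z : C) :
    Function.Bijective (fun g : Z ⟶ X ⊗ R.obj (𝟙_ D) => F.map g ≫ projL adj X) := by
  let _ := mapPairing F X Y
  let e : (Z ⟶ X ⊗ R.obj (𝟙_ D)) ≃ (F.obj Z ⟶ F.obj X) :=
    (tensorLeftHomEquiv Z X Y (R.obj (𝟙_ D))).symm.trans <|
      (adj.homEquiv _ _).symm.trans <|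
      ((μIso F Y Z).symm.homCongr (Iso.refl (𝟙_ D))).trans <|
      (tensorLeftHomEquiv (F.obj Z) (F.obj X) (F.obj Y) (𝟙_ D)).trans
        ((Iso.refl _).homCongr (ρ_ (F.obj X)))
  suffices h : (fun g : Z ⟶ X ⊗ R.obj (𝟙_ D) => F.map g ≫ projL adj X) = e by
    rw [h]; exact e.bijective
  funext g
  simp only [e, Equiv.trans_apply]
  rw [Iso.homCongr_apply, Iso.refl_inv, Category.id_comp, ← Iso.comp_inv_eq, ← Equiv.symm_apply_eq]
  rw [Iso.homCongr_apply, Iso.refl_hom, Category.comp_id, Iso.symm_inv]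
  have hcu : adj.counit.app (𝟙_ D) = counitUnit adj := rfl
  simp only [Adjunction.homEquiv_counit, hcu, tensorLeftHomEquiv, Equiv.coe_fn_symm_mk, projL]
  simp only [Functor.map_comp, Functor.Monoidal.map_whiskerLeft, Functor.Monoidal.map_whiskerRight,
      Functor.Monoidal.map_associator_inv, Functor.Monoidal.map_leftUnitor, Category.assoc,
      MonoidalCategory.whiskerLeft_comp, μIso_hom, μ_δ_assoc]
  have hev : evaluation (F.obj X) (F.obj Y) = μ F Y X ≫ F.map (evaluation X Y) ≫ η F := rfl
  rw [hev]
  simp only [comp_whiskerRight, Category.assoc]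
  rw [MonoidalCategory.whiskerLeft_hom_inv_assoc, associator_inv_naturality_right_assoc]
  rw [← leftUnitor_naturality (counitUnit adj)]
  simp only [whisker_exchange_assoc]

lemma bijective_projR (X Y : C) [ExactPairing Y X] (Z : C) :
    Function.Bijective (fun g : Z ⟶ R.obj (𝟙_ D) ⊗ X => F.map g ≫ projR adj X) := by
  let _ := mapPairing F Y X
  let e : (Z ⟶ R.obj (𝟙_ D) ⊗ X) ≃ (F.obj Z ⟶ F.obj X) :=
    (tensorRightHomEquiv Z Y X (R.obj (𝟙_ D))).symm.trans <|
      (adj.homEquiv _ _).symm.trans <|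
      ((μIso F Z Y).symm.homCongr (Iso.refl (𝟙_ D))).trans <|
      (tensorRightHomEquiv (F.obj Z) (F.obj Y) (F.obj X) (𝟙_ D)).trans
        ((Iso.refl _).homCongr (λ_ (F.obj X)))
  suffices h : (fun g : Z ⟶ R.obj (𝟙_ D) ⊗ X => F.map g ≫ projR adj X) = e by
    rw [h]; exact e.bijective
  funext g
  simp only [e, Equiv.trans_apply]
  rw [Iso.homCongr_apply, Iso.refl_inv, Category.id_comp, ← Iso.comp_inv_eq, ← Equiv.symm_apply_eq]
  rw [Iso.homCongr_apply, Iso.refl_hom, Category.comp_id, Iso.symm_inv]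
  have hcu : adj.counit.app (𝟙_ D) = counitUnit adj := rfl
  simp only [Adjunction.homEquiv_counit, hcu, tensorRightHomEquiv, Equiv.coe_fn_symm_mk, projR]
  simp only [Functor.map_comp, Functor.Monoidal.map_whiskerLeft, Functor.Monoidal.map_whiskerRight,
      Functor.Monoidal.map_associator, Functor.Monoidal.map_rightUnitor, Category.assoc,
      comp_whiskerRight, μIso_hom, μ_δ_assoc]
  have hev : evaluation (F.obj Y) (F.obj X) = μ F X Y ≫ F.map (evaluation Y X) ≫ η F := rfl
  rw [hev]
  simp only [MonoidalCategory.whiskerLeft_comp, Category.assoc]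
  rw [MonoidalCategory.hom_inv_whiskerRight_assoc, associator_naturality_left_assoc]
  rw [← rightUnitor_naturality (counitUnit adj)]
  simp only [whisker_exchange_assoc]

lemma comp_hopfL (X Z : C) (g : Z ⟶ X ⊗ R.obj (𝟙_ D)) :
    g ≫ hopfL adj X = adj.homEquiv _ _ (F.map g ≫ projL adj X) :=
  (adj.homEquiv_naturality_left g (projL adj X)).symm

lemma comp_hopfR (X Z : C) (g : Z ⟶ R.obj (𝟙_ D) ⊗ X) :
    g ≫ hopfR adj X = adj.homEquiv _ _ (F.map g ≫ projR adj X) :=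
  (adj.homEquiv_naturality_left g (projR adj X)).symm

instance isIso_hopfL [RigidCategory C] (X : C) : IsIso (hopfL adj X) := by
  have h (Z : C) : Function.Bijective (fun g : Z ⟶ X ⊗ R.obj (𝟙_ D) => g ≫ hopfL adj X) := by
    simp only [comp_hopfL]
    exact (adj.homEquiv _ _).bijective.comp (bijective_projL adj X (Xᘁ) Z)
  obtain ⟨k, hk⟩ := (h (R.obj (F.obj X))).2 (𝟙 _)
  exact ⟨k, (h _).1 (by simp only at hk ⊢; rw [Category.assoc, hk]; simp), hk⟩

instance isIso_hopfR [RigidCategory C] (X : C) : IsIso (hopfR adj X) := by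
  have h (Z : C) : Function.Bijective (fun g : Z ⟶ R.obj (𝟙_ D) ⊗ X => g ≫ hopfR adj X) := by
    simp only [comp_hopfR]
    exact (adj.homEquiv _ _).bijective.comp (bijective_projR adj X (ᘁX) Z)
  obtain ⟨k, hk⟩ := (h (R.obj (F.obj X))).2 (𝟙 _)
  exact ⟨k, (h _).1 (by simp only at hk ⊢; rw [Category.assoc, hk]; simp), hk⟩

/-- The multiplication and unit of `R 𝟙`, obtained from the lax monoidal structure of `R`. -/
@[reducible] def rightAdjointMonObj : MonObj (R.obj (𝟙_ D)) :=
  letI := adj.rightAdjointLaxMonoidal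
  R.monObjObj (𝟙_ D)

lemma map_one_counit :
    F.map (rightAdjointMonObj adj).one ≫ counitUnit adj = η F := by
  let _ := adj.rightAdjointLaxMonoidal
  have h : (rightAdjointMonObj adj).one = adj.homEquiv _ _ (η F) := by
    change adj.homEquiv _ _ (η F) ≫ R.map (𝟙 _) = _
    simp
  rw [h, counitUnit, ← Adjunction.homEquiv_counit, Equiv.symm_apply_apply]

lemma map_mul_counit :
    F.map (rightAdjointMonObj adj).mul ≫ counitUnit adj =
      δ F (R.obj (𝟙_ D)) (R.obj (𝟙_ D)) ≫ (counitUnit adj ⊗ₘ counitUnit adj) ≫ (λ_ (𝟙_ D)).hom := by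
  let _ := adj.rightAdjointLaxMonoidal
  have h : (rightAdjointMonObj adj).mul = adj.homEquiv _ _
      ((δ F (R.obj (𝟙_ D)) (R.obj (𝟙_ D)) ≫ (counitUnit adj ⊗ₘ counitUnit adj)) ≫
        (λ_ (𝟙_ D)).hom) := by
    rw [adj.homEquiv_naturality_right]
    rfl
  rw [h, counitUnit, ← Adjunction.homEquiv_counit, Equiv.symm_apply_apply, Category.assoc]

section
variable [RigidCategory C]

/-- The isomorphism `σ_X : R 𝟙 ⊗ X ≅ X ⊗ R 𝟙`, composed of the canonical isomorphisms
`R 𝟙 ⊗ X ≅ R (F X)` and `R (F X) ≅ X ⊗ R 𝟙`. -/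
noncomputable def sigma (X : C) : R.obj (𝟙_ D) ⊗ X ≅ X ⊗ R.obj (𝟙_ D) :=
  asIso (hopfR adj X) ≪≫ (asIso (hopfL adj X)).symm

lemma sigma_spec (X : C) : F.map (sigma adj X).hom ≫ projL adj X = projR adj X := by
  apply (adj.homEquiv _ _).injective
  rw [← comp_hopfL]
  simp [sigma, hopfR]

lemma eq_of_projL {X Z : C} {g h : Z ⟶ X ⊗ R.obj (𝟙_ D)}
    (w : F.map g ≫ projL adj X = F.map h ≫ projL adj X) : g = h :=
  (bijective_projL adj X (Xᘁ) Z).1 w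

/-- The half-braiding on `R 𝟙` formed by the isomorphisms `sigma`. -/
noncomputable def halfBraiding : HalfBraiding (R.obj (𝟙_ D)) where
  β := sigma adj
  naturality {U U'} f := by
    apply eq_of_projL adj
    simp only [Functor.map_comp, Category.assoc, sigma_spec, projR_naturality, projL_naturality]
    rw [← Category.assoc, sigma_spec]
  monoidal U U' := by
    apply eq_of_projL adj
    rw [sigma_spec]
    rw [← cancel_mono (δ F U U'), projR_tensor]
    simp only [Functor.map_comp, Category.assoc]
    rw [← projL_tensor, ← Functor.map_comp_assoc F (α_ U U' _).inv, Iso.inv_hom_id, CategoryTheory.Functor.map_id,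
      Category.id_comp, Functor.Monoidal.map_whiskerLeft]
    simp only [Category.assoc, μ_δ_assoc]
    rw [← MonoidalCategory.whiskerLeft_comp, sigma_spec, projM_tensor,
      Functor.Monoidal.map_whiskerRight]
    simp only [Category.assoc, μ_δ_assoc]
    rw [← comp_whiskerRight, sigma_spec]
/-- The induced central algebra `(R 𝟙, σ)` of a monoidal functor `F` with right adjoint `R`, as an
object of the Drinfeld center. Its algebra structure is the instance below. -/
noncomputable def inducedCentralAlgebra : Center C := ⟨R.obj (𝟙_ D), halfBraiding adj⟩

lemma one_sigma (U : C) : (rightAdjointMonObj adj).one ▷ U ≫ (sigma adj U).hom =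
    ((λ_ U).hom ≫ (ρ_ U).inv) ≫ U ◁ (rightAdjointMonObj adj).one := by
  apply eq_of_projL adj
  simp only [Functor.map_comp, Category.assoc, sigma_spec]
  simp only [projL, projR, Functor.Monoidal.map_whiskerLeft, Functor.Monoidal.map_whiskerRight,
    Category.assoc, μ_δ_assoc, Functor.Monoidal.map_leftUnitor, Functor.Monoidal.map_rightUnitor_inv]
  rw [← comp_whiskerRight_assoc, ← MonoidalCategory.whiskerLeft_comp_assoc (F.obj U) (F.map _)
    (counitUnit adj), map_one_counit]
  simp

lemma map_mul_whiskerRight_projR (U : C) :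
    F.map ((rightAdjointMonObj adj).mul ▷ U) ≫ projR adj U =
      F.map (α_ _ _ _).hom ≫ projR adj (R.obj (𝟙_ D) ⊗ U) ≫ projR adj U := by
  have h : F.map (rightAdjointMonObj adj).mul ≫ counitUnit adj =
      projR adj (R.obj (𝟙_ D)) ≫ counitUnit adj := by
    rw [map_mul_counit, projR, MonoidalCategory.tensorHom_def]; simp
  conv_rhs => rw [projR.eq_def adj U]
  rw [← Category.assoc (projR adj _), projR_tensor]
  simp only [Category.assoc]
  rw [← comp_whiskerRight_assoc, ← h, projR, Functor.Monoidal.map_whiskerRight]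
  simp

lemma map_whiskerLeft_mul_projL (U : C) :
    F.map ((α_ _ _ _).hom ≫ U ◁ (rightAdjointMonObj adj).mul) ≫ projL adj U =
      δ F _ _ ≫ projL adj U ▷ _ ≫ F.obj U ◁ counitUnit adj ≫ (ρ_ _).hom := by
  have h : F.map (rightAdjointMonObj adj).mul ≫ counitUnit adj =
      projR adj (R.obj (𝟙_ D)) ≫ counitUnit adj := by
    rw [map_mul_counit, projR, MonoidalCategory.tensorHom_def]; simp
  rw [Functor.map_comp, projL, Functor.Monoidal.map_whiskerLeft]
  simp only [Category.assoc, μ_δ_assoc]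
  rw [← MonoidalCategory.whiskerLeft_comp_assoc, h, MonoidalCategory.whiskerLeft_comp_assoc,
    ← Category.assoc (δ F _ _), ← Category.assoc (F.map _), projM_tensor]
  simp [projL]

lemma mul_sigma (U : C) : (rightAdjointMonObj adj).mul ▷ U ≫ (sigma adj U).hom =
    ((α_ _ _ _).hom ≫ R.obj (𝟙_ D) ◁ (sigma adj U).hom ≫ (α_ _ _ _).inv ≫
      (sigma adj U).hom ▷ R.obj (𝟙_ D) ≫ (α_ _ _ _).hom) ≫ U ◁ (rightAdjointMonObj adj).mul := by
  apply eq_of_projL adj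
  have h1 : F.map ((sigma adj U).hom ▷ R.obj (𝟙_ D)) ≫ δ F _ _ ≫
      projL adj U ▷ _ ≫ F.obj U ◁ counitUnit adj ≫ (ρ_ _).hom = 
      δ F _ _ ≫ projR adj U ▷ _ ≫ F.obj U ◁ counitUnit adj ≫ (ρ_ _).hom := by
    rw [Functor.Monoidal.map_whiskerRight]
    simp only [Category.assoc, μ_δ_assoc]
    rw [← comp_whiskerRight_assoc, sigma_spec]
  have h2 : F.map (α_ _ _ _).inv ≫ δ F _ _ ≫ projR adj U ▷ _ ≫ F.obj U ◁ counitUnit adj ≫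
      (ρ_ _).hom = projR adj (U ⊗ R.obj (𝟙_ D)) ≫ projL adj U := by
    conv_rhs => rw [projL]
    rw [← Category.assoc (projR adj _), projR_tensor]
    simp only [Category.assoc]
  rw [Functor.map_comp, Category.assoc, sigma_spec, map_mul_whiskerRight_projR]
  simp only [Category.assoc]
  rw [Functor.map_comp, Functor.map_comp, Functor.map_comp, Functor.map_comp]
  simp only [Category.assoc]
  rw [map_whiskerLeft_mul_projL, h1, h2, ← Category.assoc (F.map (_ ◁ _)), projR_naturality,
    Category.assoc, sigma_spec]

/-- The multiplication and unit of `R 𝟙` are morphisms in the Drinfeld center. -/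
noncomputable instance : MonObj (inducedCentralAlgebra adj) where
  one := ⟨(rightAdjointMonObj adj).one, one_sigma adj⟩
  mul := ⟨(rightAdjointMonObj adj).mul, mul_sigma adj⟩
  one_mul := Center.ext _ _ (rightAdjointMonObj adj).one_mul
  mul_one := Center.ext _ _ (rightAdjointMonObj adj).mul_one
  mul_assoc := Center.ext _ _ (rightAdjointMonObj adj).mul_assoc

end
end Proj

section Coend
open Functor.LaxMonoidal Functor.OplaxMonoidal

variable (k : Type w) [Field k] {C : Type u₁} [Category.{v₁} C]
  {D : Type u₂} [Category.{v₂} D] [Preadditive D] [CategoryTheory.Linear k D]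
  [MonoidalCategory D]

/-- The value at `X` of the functor `Hom(𝟙, Φ -)`. -/
abbrev Fiber (Φ : C ⥤ D) (X : C) : Type v₂ := 𝟙_ D ⟶ Φ.obj X

/-- The action of the functor `Hom(𝟙, Φ -)` on morphisms. -/
abbrev fiberMap (Φ : C ⥤ D) {X Y : C} (g : X ⟶ Y) : Fiber Φ X →ₗ[k] Fiber Φ Y :=
  CategoryTheory.Linear.rightComp k (𝟙_ D) (Φ.map g)

/-- The direct sum of all `ω(X)^* ⊗ ω(X)`, where `ω = Hom(𝟙, Φ -)`. -/
abbrev CoendSum (Φ : C ⥤ D) : Type (max u₁ w v₂) :=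
  ⨁ X : C, (Module.Dual k (Fiber Φ X) ⊗[k] Fiber Φ X)

noncomputable instance (Φ : C ⥤ D) : AddCommGroup (CoendSum k Φ) :=
  Module.addCommMonoidToAddCommGroup k

open Classical in
/-- The inclusion of a summand. -/
noncomputable abbrev coendι (Φ : C ⥤ D) (X : C) :
    (Module.Dual k (Fiber Φ X) ⊗[k] Fiber Φ X) →ₗ[k] CoendSum k Φ :=
  DirectSum.lof k C (fun X => Module.Dual k (Fiber Φ X) ⊗[k] Fiber Φ X) X

/-- The dinaturality relations `[φ ∘ ω(g) ⊗ v] = [φ ⊗ ω(g) v]` for `g : X ⟶ Y`. -/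
def coendRel (Φ : C ⥤ D) : Submodule k (CoendSum k Φ) :=
  Submodule.span k {z | ∃ (X Y : C) (g : X ⟶ Y) (φ : Module.Dual k (Fiber Φ Y)) (v : Fiber Φ X),
    z = coendι k Φ X ((φ ∘ₗ fiberMap k Φ g) ⊗ₜ v) - coendι k Φ Y (φ ⊗ₜ fiberMap k Φ g v)}

/-- The coend `∫^X ω(X)^* ⊗ ω(X)` of `ω = Hom(𝟙, Φ -)`, as a quotient of `⨁ X, ω(X)^* ⊗ ω(X)`. -/
def Coend (Φ : C ⥤ D) : Type (max u₁ w v₂) := CoendSum k Φ ⧸ coendRel k Φ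

noncomputable instance (Φ : C ⥤ D) : AddCommGroup (Coend k Φ) :=
  inferInstanceAs (AddCommGroup (CoendSum k Φ ⧸ coendRel k Φ))

noncomputable instance (Φ : C ⥤ D) : Module k (Coend k Φ) :=
  inferInstanceAs (Module k (CoendSum k Φ ⧸ coendRel k Φ))

/-- The structure map of the coend. -/
noncomputable def coendIn (Φ : C ⥤ D) (X : C) :
    (Module.Dual k (Fiber Φ X) ⊗[k] Fiber Φ X) →ₗ[k] Coend k Φ :=
  (coendRel k Φ).mkQ ∘ₗ coendι k Φ X

variable {k} in
lemma coendIn_dinatural {Φ : C ⥤ D} {X Y : C} (g : X ⟶ Y) (φ : Module.Dual k (Fiber Φ Y))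
    (v : Fiber Φ X) :
    coendIn k Φ X ((φ ∘ₗ fiberMap k Φ g) ⊗ₜ v) = coendIn k Φ Y (φ ⊗ₜ fiberMap k Φ g v) :=
  (Submodule.Quotient.eq _).2 (Submodule.subset_span ⟨X, Y, g, φ, v, rfl⟩)

section
open Classical in
/-- Universal property of the coend. -/
noncomputable def coendLift {Φ : C ⥤ D} {M : Type*} [AddCommGroup M] [Module k M]
    (t : ∀ X : C, (Module.Dual k (Fiber Φ X) ⊗[k] Fiber Φ X) →ₗ[k] M)
    (ht : ∀ (X Y : C) (g : X ⟶ Y) (φ : Module.Dual k (Fiber Φ Y)) (v : Fiber Φ X),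
      t X ((φ ∘ₗ fiberMap k Φ g) ⊗ₜ v) = t Y (φ ⊗ₜ fiberMap k Φ g v)) : Coend k Φ →ₗ[k] M :=
  (coendRel k Φ).liftQ (DirectSum.toModule k C M t) <| by
    rw [coendRel, Submodule.span_le]
    rintro _ ⟨X, Y, g, φ, v, rfl⟩
    simp only [SetLike.mem_coe, LinearMap.mem_ker, map_sub, coendι, DirectSum.toModule_lof]
    rw [ht, sub_self]

open Classical in
lemma coendLift_coendIn {Φ : C ⥤ D} {M : Type*} [AddCommGroup M] [Module k M]
    (t : ∀ X : C, (Module.Dual k (Fiber Φ X) ⊗[k] Fiber Φ X) →ₗ[k] M) (ht) (X : C)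
    (z : Module.Dual k (Fiber Φ X) ⊗[k] Fiber Φ X) :
    coendLift k t ht (coendIn k Φ X z) = t X z := by
  refine (Submodule.liftQ_apply _ _ _).trans ?_
  simp only [coendι, DirectSum.toModule_lof]

variable {k} in
open Classical in
lemma coend_hom_ext {Φ : C ⥤ D} {M : Type*} [AddCommGroup M] [Module k M]
    {s t : Coend k Φ →ₗ[k] M}
    (h : ∀ (X : C) (φ : Module.Dual k (Fiber Φ X)) (v : Fiber Φ X),
      s (coendIn k Φ X (φ ⊗ₜ v)) = t (coendIn k Φ X (φ ⊗ₜ v))) : s = t := by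
  refine Submodule.linearMap_qext _ (DirectSum.linearMap_ext k fun X => TensorProduct.ext' ?_)
  exact fun φ v => h X φ v
end

variable [MonoidalCategory C] [MonoidalPreadditive D] [MonoidalLinear k D]

/-- The lax monoidal constraint `ω(X) ⊗ ω(Y) → ω(X ⊗ Y)` of `ω = Hom(𝟙, Φ -)`. -/
noncomputable def fiberTensor (Φ : C ⥤ D) [Φ.Monoidal] (X Y : C) :
    (Fiber Φ X ⊗[k] Fiber Φ Y) →ₗ[k] Fiber Φ (X ⊗ Y) :=
  TensorProduct.lift <| LinearMap.mk₂ k (fun v w => (λ_ (𝟙_ D)).inv ≫ (v ⊗ₘ w) ≫ μ Φ X Y)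
    (by intros; simp [MonoidalPreadditive.add_tensor])
    (by intros; simp [MonoidalCategory.tensorHom_def])
    (by intros; simp [MonoidalPreadditive.tensor_add])
    (by intros; simp [MonoidalCategory.tensorHom_def])

/-- The lax monoidal unit constraint `k → ω(𝟙)`. -/
noncomputable def fiberUnit (Φ : C ⥤ D) [Φ.Monoidal] : k →ₗ[k] Fiber Φ (𝟙_ C) :=
  LinearMap.toSpanSingleton k _ (ε Φ)

/-- The functor `ω = Hom(𝟙, Φ -)` is strong monoidal. -/
class HasStrongFiber (Φ : C ⥤ D) [Φ.Monoidal] : Prop where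
  bijective_fiberTensor : ∀ X Y : C, Function.Bijective (fiberTensor k Φ X Y)
  bijective_fiberUnit : Function.Bijective (fiberUnit k Φ)

variable (Φ : C ⥤ D) [Φ.Monoidal]

lemma fiberTensor_tmul (X Y : C) (v : Fiber Φ X) (w : Fiber Φ Y) :
    fiberTensor k Φ X Y (v ⊗ₜ w) = (λ_ (𝟙_ D)).inv ≫ (v ⊗ₘ w) ≫ μ Φ X Y := rfl

lemma fiberTensor_naturality {X X' Y Y' : C} (g : X ⟶ X') (h : Y ⟶ Y') (v : Fiber Φ X)
    (w : Fiber Φ Y) : fiberMap k Φ (g ⊗ₘ h) (fiberTensor k Φ X Y (v ⊗ₜ w)) =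
      fiberTensor k Φ X' Y' (fiberMap k Φ g v ⊗ₜ fiberMap k Φ h w) := by
  simp only [fiberTensor_tmul, Linear.rightComp_apply, Category.assoc]
  rw [← μ_natural, tensorHom_comp_tensorHom_assoc]

lemma fiberTensor_assoc (X Y Z : C) (v : Fiber Φ X) (w : Fiber Φ Y) (u : Fiber Φ Z) :
    fiberMap k Φ (α_ X Y Z).hom
      (fiberTensor k Φ (X ⊗ Y) Z (fiberTensor k Φ X Y (v ⊗ₜ w) ⊗ₜ u)) =
    fiberTensor k Φ X (Y ⊗ Z) (v ⊗ₜ fiberTensor k Φ Y Z (w ⊗ₜ u)) := by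
  simp only [fiberTensor_tmul, Linear.rightComp_apply, Category.assoc]
  have h1 : ((λ_ (𝟙_ D)).inv ≫ (v ⊗ₘ w) ≫ μ Φ X Y) ⊗ₘ u =
      (λ_ (𝟙_ D)).inv ▷ 𝟙_ D ≫ ((v ⊗ₘ w) ⊗ₘ u) ≫ μ Φ X Y ▷ Φ.obj Z := by
    rw [← tensorHom_id, ← tensorHom_id, tensorHom_comp_tensorHom, tensorHom_comp_tensorHom]
    simp
  have h2 : v ⊗ₘ ((λ_ (𝟙_ D)).inv ≫ (w ⊗ₘ u) ≫ μ Φ Y Z) =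
      𝟙_ D ◁ (λ_ (𝟙_ D)).inv ≫ (v ⊗ₘ (w ⊗ₘ u)) ≫ Φ.obj X ◁ μ Φ Y Z := by
    rw [← id_tensorHom, ← id_tensorHom, tensorHom_comp_tensorHom, tensorHom_comp_tensorHom]
    simp
  rw [h1, h2]
  have h3 : (λ_ (𝟙_ D)).inv ≫ (λ_ (𝟙_ D)).inv ▷ 𝟙_ D ≫ (α_ _ _ _).hom =
      (λ_ (𝟙_ D)).inv ≫ 𝟙_ D ◁ (λ_ (𝟙_ D)).inv := by monoidal
  simp only [Category.assoc, Functor.LaxMonoidal.associativity, associator_naturality_assoc]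
  rw [reassoc_of% h3]

lemma fiberTensor_leftUnitor (X : C) (v : Fiber Φ X) :
    fiberMap k Φ (λ_ X).hom (fiberTensor k Φ (𝟙_ C) X ((ε Φ : Fiber Φ (𝟙_ C)) ⊗ₜ v)) = v := by
  simp only [fiberTensor_tmul, Linear.rightComp_apply, Category.assoc]
  rw [MonoidalCategory.tensorHom_def']
  simp

lemma fiberTensor_rightUnitor (X : C) (v : Fiber Φ X) :
    fiberMap k Φ (ρ_ X).hom (fiberTensor k Φ X (𝟙_ C) (v ⊗ₜ (ε Φ : Fiber Φ (𝟙_ C)))) = v := by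
  simp only [fiberTensor_tmul, Linear.rightComp_apply, Category.assoc]
  rw [MonoidalCategory.tensorHom_def, unitors_inv_equal]
  simp

variable [HasStrongFiber k Φ]

/-- The isomorphism `ω(X) ⊗ ω(Y) ≃ ω(X ⊗ Y)`. -/
noncomputable def fiberTensorEquiv (X Y : C) :
    (Fiber Φ X ⊗[k] Fiber Φ Y) ≃ₗ[k] Fiber Φ (X ⊗ Y) :=
  LinearEquiv.ofBijective _ (HasStrongFiber.bijective_fiberTensor (k := k) X Y)

/-- The isomorphism `k ≃ ω(𝟙)`. -/
noncomputable def fiberUnitEquiv : k ≃ₗ[k] Fiber Φ (𝟙_ C) :=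
  LinearEquiv.ofBijective _ (HasStrongFiber.bijective_fiberUnit (k := k) (Φ := Φ))

/-- The map `ω(X)^* ⊗ ω(Y)^* → ω(X ⊗ Y)^*`. -/
noncomputable def dualTensor (X Y : C) :
    (Module.Dual k (Fiber Φ X) ⊗[k] Module.Dual k (Fiber Φ Y)) →ₗ[k]
      Module.Dual k (Fiber Φ (X ⊗ Y)) :=
  (fiberTensorEquiv k Φ X Y).symm.toLinearMap.dualMap ∘ₗ
    TensorProduct.dualDistrib k (Fiber Φ X) (Fiber Φ Y)

lemma dualTensor_apply (X Y : C) (φ : Module.Dual k (Fiber Φ X)) (ψ : Module.Dual k (Fiber Φ Y))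
    (v : Fiber Φ X) (w : Fiber Φ Y) :
    dualTensor k Φ X Y (φ ⊗ₜ ψ) (fiberTensor k Φ X Y (v ⊗ₜ w)) = φ v * ψ w := by
  have h : fiberTensor k Φ X Y (v ⊗ₜ w) = fiberTensorEquiv k Φ X Y (v ⊗ₜ w) := rfl
  rw [h]
  simp [dualTensor]

variable {k Φ} in
lemma fiber_dual_ext {X Y : C} {s t : Module.Dual k (Fiber Φ (X ⊗ Y))}
    (h : ∀ v w, s (fiberTensor k Φ X Y (v ⊗ₜ w)) = t (fiberTensor k Φ X Y (v ⊗ₜ w))) : s = t := by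
  have h2 : s ∘ₗ (fiberTensorEquiv k Φ X Y).toLinearMap =
      t ∘ₗ (fiberTensorEquiv k Φ X Y).toLinearMap := TensorProduct.ext' h
  ext z
  obtain ⟨y, rfl⟩ := (fiberTensorEquiv k Φ X Y).surjective z
  exact LinearMap.congr_fun h2 y

/-- The multiplication on components: `(φ ⊗ v, ψ ⊗ w) ↦ (φ ⊗ ψ) ⊗ (v ⊗ w)`. -/
noncomputable def coendMulAux (X Y : C) :
    (Module.Dual k (Fiber Φ X) ⊗[k] Fiber Φ X) →ₗ[k]
      (Module.Dual k (Fiber Φ Y) ⊗[k] Fiber Φ Y) →ₗ[k] Coend k Φ :=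
  TensorProduct.curry (coendIn k Φ (X ⊗ Y) ∘ₗ
    TensorProduct.map (dualTensor k Φ X Y) (fiberTensor k Φ X Y) ∘ₗ
    (TensorProduct.tensorTensorTensorComm k _ _ _ _).toLinearMap)

lemma coendMulAux_tmul (X Y : C) (φ : Module.Dual k (Fiber Φ X)) (v : Fiber Φ X)
    (ψ : Module.Dual k (Fiber Φ Y)) (w : Fiber Φ Y) :
    coendMulAux k Φ X Y (φ ⊗ₜ v) (ψ ⊗ₜ w) =
      coendIn k Φ (X ⊗ Y) (dualTensor k Φ X Y (φ ⊗ₜ ψ) ⊗ₜ fiberTensor k Φ X Y (v ⊗ₜ w)) := rfl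

lemma coendMulAux_right (X : C) (z : Module.Dual k (Fiber Φ X) ⊗[k] Fiber Φ X) (Y Y' : C)
    (g : Y ⟶ Y') (ψ : Module.Dual k (Fiber Φ Y')) (w : Fiber Φ Y) :
    coendMulAux k Φ X Y z ((ψ ∘ₗ fiberMap k Φ g) ⊗ₜ w) =
      coendMulAux k Φ X Y' z (ψ ⊗ₜ fiberMap k Φ g w) := by
  induction z using TensorProduct.induction_on with
  | zero => simp
  | add a b ha hb => simp only [map_add, LinearMap.add_apply, ha, hb]
  | tmul φ v =>
    rw [coendMulAux_tmul, coendMulAux_tmul]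
    have h1 : dualTensor k Φ X Y (φ ⊗ₜ (ψ ∘ₗ fiberMap k Φ g)) =
        dualTensor k Φ X Y' (φ ⊗ₜ ψ) ∘ₗ fiberMap k Φ (𝟙 X ⊗ₘ g) := by
      apply fiber_dual_ext
      intro a b
      rw [dualTensor_apply, LinearMap.comp_apply, LinearMap.comp_apply, fiberTensor_naturality, dualTensor_apply]
      simp
    rw [h1, coendIn_dinatural, fiberTensor_naturality]
    simp

lemma coendMulAux_left (Y : C) (z : Module.Dual k (Fiber Φ Y) ⊗[k] Fiber Φ Y) (X X' : C)
    (g : X ⟶ X') (φ : Module.Dual k (Fiber Φ X')) (v : Fiber Φ X) :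
    coendMulAux k Φ X Y ((φ ∘ₗ fiberMap k Φ g) ⊗ₜ v) z =
      coendMulAux k Φ X' Y (φ ⊗ₜ fiberMap k Φ g v) z := by
  induction z using TensorProduct.induction_on with
  | zero => simp
  | add a b ha hb => simp only [map_add, ha, hb]
  | tmul ψ w =>
    rw [coendMulAux_tmul, coendMulAux_tmul]
    have h1 : dualTensor k Φ X Y ((φ ∘ₗ fiberMap k Φ g) ⊗ₜ ψ) =
        dualTensor k Φ X' Y (φ ⊗ₜ ψ) ∘ₗ fiberMap k Φ (g ⊗ₘ 𝟙 Y) := by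
      apply fiber_dual_ext
      intro a b
      rw [dualTensor_apply, LinearMap.comp_apply, LinearMap.comp_apply, fiberTensor_naturality, dualTensor_apply]
      simp
    rw [h1, coendIn_dinatural, fiberTensor_naturality]
    simp

/-- The multiplication of the coend: `[φ ⊗ v] [ψ ⊗ w] = [(φ ⊗ ψ) ⊗ (v ⊗ w)]`. -/
noncomputable def coendMul : Coend k Φ →ₗ[k] Coend k Φ →ₗ[k] Coend k Φ :=
  coendLift k (fun X => LinearMap.flip (coendLift k (fun Y => (coendMulAux k Φ X Y).flip)
    (fun Y Y' g ψ w => LinearMap.ext fun z => coendMulAux_right k Φ X z Y Y' g ψ w)))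
    (fun X X' g φ v => coend_hom_ext fun Y ψ w => by
      simp only [LinearMap.flip_apply, coendLift_coendIn]
      exact coendMulAux_left k Φ Y (ψ ⊗ₜ w) X X' g φ v)

lemma coendMul_apply (X Y : C) (φ : Module.Dual k (Fiber Φ X)) (v : Fiber Φ X)
    (ψ : Module.Dual k (Fiber Φ Y)) (w : Fiber Φ Y) :
    coendMul k Φ (coendIn k Φ X (φ ⊗ₜ v)) (coendIn k Φ Y (ψ ⊗ₜ w)) =
      coendIn k Φ (X ⊗ Y) (dualTensor k Φ X Y (φ ⊗ₜ ψ) ⊗ₜ fiberTensor k Φ X Y (v ⊗ₜ w)) := by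
  simp only [coendMul, coendLift_coendIn, LinearMap.flip_apply, coendMulAux_tmul]

/-- The unit of the coend. -/
noncomputable def coendOne : Coend k Φ :=
  coendIn k Φ (𝟙_ C) ((fiberUnitEquiv k Φ).symm.toLinearMap ⊗ₜ (ε Φ))

lemma coendMul_assoc (a b c : Coend k Φ) :
    coendMul k Φ (coendMul k Φ a b) c = coendMul k Φ a (coendMul k Φ b c) := by
  suffices h : coendMul k Φ (coendMul k Φ a b) = coendMul k Φ a ∘ₗ coendMul k Φ b from
    LinearMap.congr_fun h c
  refine coend_hom_ext fun Z χ u => ?_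
  suffices h : (coendMul k Φ).flip (coendIn k Φ Z (χ ⊗ₜ u)) ∘ₗ coendMul k Φ a =
      coendMul k Φ a ∘ₗ (coendMul k Φ).flip (coendIn k Φ Z (χ ⊗ₜ u)) from LinearMap.congr_fun h b
  refine coend_hom_ext fun Y ψ w => ?_
  suffices h : (coendMul k Φ).flip (coendIn k Φ Z (χ ⊗ₜ u)) ∘ₗ
      (coendMul k Φ).flip (coendIn k Φ Y (ψ ⊗ₜ w)) =
      (coendMul k Φ).flip (coendMul k Φ (coendIn k Φ Y (ψ ⊗ₜ w)) (coendIn k Φ Z (χ ⊗ₜ u))) from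
    LinearMap.congr_fun h a
  refine coend_hom_ext fun X φ v => ?_
  simp only [LinearMap.comp_apply, LinearMap.flip_apply, coendMul_apply]
  have h1 : dualTensor k Φ (X ⊗ Y) Z (dualTensor k Φ X Y (φ ⊗ₜ ψ) ⊗ₜ χ) =
      dualTensor k Φ X (Y ⊗ Z) (φ ⊗ₜ dualTensor k Φ Y Z (ψ ⊗ₜ χ)) ∘ₗ
        fiberMap k Φ (α_ X Y Z).hom := by
    refine fiber_dual_ext fun p q => ?_
    obtain ⟨p, rfl⟩ := (fiberTensorEquiv k Φ X Y).surjective p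
    have hp : fiberTensorEquiv k Φ X Y p = fiberTensor k Φ X Y p := rfl
    rw [hp]
    induction p using TensorProduct.induction_on with
    | zero => simp
    | add p p' h h' =>
      simp only [map_add, TensorProduct.add_tmul]
      rw [h rfl, h' rfl]
    | tmul s t =>
      rw [dualTensor_apply, dualTensor_apply, LinearMap.comp_apply, fiberTensor_assoc,
        dualTensor_apply, dualTensor_apply, mul_assoc]
  rw [h1, coendIn_dinatural, fiberTensor_assoc]

lemma coendOne_mul (a : Coend k Φ) : coendMul k Φ (coendOne k Φ) a = a := by
  suffices h : coendMul k Φ (coendOne k Φ) = LinearMap.id from LinearMap.congr_fun h a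
  apply coend_hom_ext
  intro X φ v
  rw [coendOne, coendMul_apply]
  have h1 : dualTensor k Φ (𝟙_ C) X ((fiberUnitEquiv k Φ).symm.toLinearMap ⊗ₜ φ) =
      φ ∘ₗ fiberMap k Φ (λ_ X).hom := by
    apply fiber_dual_ext
    intro a b
    obtain ⟨c, rfl⟩ := (fiberUnitEquiv k Φ).surjective a
    have hc : fiberUnitEquiv k Φ c = c • (ε Φ) := rfl
    have hs : (fiberUnitEquiv k Φ).symm.toLinearMap (fiberUnitEquiv k Φ c) = c :=
      LinearEquiv.symm_apply_apply _ c
    rw [dualTensor_apply, LinearMap.comp_apply, hs, hc,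
      ← TensorProduct.smul_tmul', LinearMap.map_smul (fiberTensor k Φ _ _), LinearMap.map_smul (fiberMap k Φ _),
      LinearMap.map_smul φ, fiberTensor_leftUnitor]
    simp
  rw [h1, coendIn_dinatural, fiberTensor_leftUnitor]
  rfl

lemma coendMul_one (a : Coend k Φ) : coendMul k Φ a (coendOne k Φ) = a := by
  suffices h : (coendMul k Φ).flip (coendOne k Φ) = LinearMap.id from LinearMap.congr_fun h a
  apply coend_hom_ext
  intro X φ v
  rw [coendOne, LinearMap.flip_apply, coendMul_apply]
  have h1 : dualTensor k Φ X (𝟙_ C) (φ ⊗ₜ (fiberUnitEquiv k Φ).symm.toLinearMap) =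
      φ ∘ₗ fiberMap k Φ (ρ_ X).hom := by
    apply fiber_dual_ext
    intro a b
    obtain ⟨c, rfl⟩ := (fiberUnitEquiv k Φ).surjective b
    have hc : fiberUnitEquiv k Φ c = c • (ε Φ) := rfl
    have hs : (fiberUnitEquiv k Φ).symm.toLinearMap (fiberUnitEquiv k Φ c) = c :=
      LinearEquiv.symm_apply_apply _ c
    rw [dualTensor_apply, LinearMap.comp_apply, hs, hc,
      TensorProduct.tmul_smul, LinearMap.map_smul (fiberTensor k Φ _ _), LinearMap.map_smul (fiberMap k Φ _),
      LinearMap.map_smul φ, fiberTensor_rightUnitor]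
    simp [mul_comm]
  rw [h1, coendIn_dinatural, fiberTensor_rightUnitor]
  rfl

/-- The coend of `Hom(𝟙, Φ -)` with its multiplication is a ring. -/
@[reducible] noncomputable def coendRing : Ring (Coend k Φ) where
  __ := (inferInstance : AddCommGroup (Coend k Φ))
  mul a b := coendMul k Φ a b
  one := coendOne k Φ
  mul_assoc := coendMul_assoc k Φ
  one_mul := coendOne_mul k Φ
  mul_one := coendMul_one k Φ
  left_distrib a b c := (coendMul k Φ a).map_add b c
  right_distrib a b c := by
    change coendMul k Φ (a + b) c = coendMul k Φ a c + coendMul k Φ b c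
    rw [map_add, LinearMap.add_apply]
  zero_mul a := by
    change coendMul k Φ 0 a = 0
    rw [map_zero, LinearMap.zero_apply]
  mul_zero a := (coendMul k Φ a).map_zero

/-- The `k`-algebra structure of the coend. -/
@[reducible] noncomputable def coendAlgebra :
    letI := coendRing k Φ
    Algebra k (Coend k Φ) :=
  letI := coendRing k Φ
  Algebra.ofModule
    (fun r x y => by
      change coendMul k Φ (r • x) y = r • coendMul k Φ x y
      rw [map_smul, LinearMap.smul_apply])
    (fun r x y => (coendMul k Φ x).map_smul r y)

end Coend

section Tensor

attribute [local instance] Abelian.hasFiniteBiproducts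

/-- `C` is a tensor category over `k`: a `k`-linear abelian rigid monoidal category with `k`-bilinear
tensor product, finite-dimensional Hom spaces, objects of finite length (that is, both
Noetherian and Artinian) and simple unit object. -/
class IsTensorCategory (k : Type w) [Field k] (C : Type u) [Category.{v} C] [Abelian C]
    [CategoryTheory.Linear k C] [MonoidalCategory C] [RigidCategory C] : Prop
    extends MonoidalPreadditive C, MonoidalLinear k C where
  finite_hom : ∀ X Y : C, Module.Finite k (X ⟶ Y)
  isNoetherianObject : ∀ X : C, IsNoetherianObject X
  isArtinianObject : ∀ X : C, IsArtinianObject X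
  simple_unit : Simple (𝟙_ C)

attribute [instance] IsTensorCategory.finite_hom IsTensorCategory.simple_unit

/-- A tensor functor: a `k`-linear exact (strong) monoidal functor. -/
class IsTensorFunctor (k : Type w) [Field k] {C : Type u₁} [Category.{v₁} C] [Abelian C]
    [CategoryTheory.Linear k C] [MonoidalCategory C] {D : Type u₂} [Category.{v₂} D] [Abelian D]
    [CategoryTheory.Linear k D] [MonoidalCategory D] (F : C ⥤ D) [F.Monoidal] : Prop where
  additive : F.Additive
  linear : F.Linear k
  preservesFiniteLimits : PreservesFiniteLimits F
  preservesFiniteColimits : PreservesFiniteColimits F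

/-- An object is trivial if it is isomorphic to `𝟙ⁿ` for some natural number `n`. -/
def IsTrivial {C : Type u} [Category.{v} C] [Abelian C] [MonoidalCategory C] (X : C) : Prop :=
  ∃ n : ℕ, Nonempty (X ≅ ⨁ fun _ : Fin n => 𝟙_ C)

variable {C : Type u₁} [Category.{v₁} C]
  {D : Type u₂} [Category.{v₂} D] [Abelian D] [MonoidalCategory D]

/-- Every object of the target is a subobject of some `F X`. -/
def IsDominant (F : C ⥤ D) : Prop :=
  ∀ Y : D, ∃ (X : C) (j : Y ⟶ F.obj X), Mono j

/-- For every `X` there is a subobject `X₀` of `X` such that `F X₀` is the largest trivial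
subobject of `F X`. -/
def IsNormal (F : C ⥤ D) : Prop :=
  ∀ X : C, ∃ (X₀ : C) (i : X₀ ⟶ X), Mono i ∧ Mono (F.map i) ∧ IsTrivial (F.obj X₀) ∧
    ∀ (T : D) (j : T ⟶ F.obj X), Mono j → IsTrivial T → ∃ g : T ⟶ F.obj X₀, g ≫ F.map i = j

variable {C' : Type u₃} [Category.{v₃} C']

/-- `C' ⟶ C ⟶ D` is exact: `F` is dominant and normal, and `f` is a full embedding whose
essential image consists of the objects `X` with `F X` trivial. -/
structure IsExactSequence (f : C' ⥤ C) (F : C ⥤ D) : Prop where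
  dominant : IsDominant F
  normal : IsNormal F
  full : f.Full
  faithful : f.Faithful
  essImage_iff : ∀ X : C, f.essImage X ↔ IsTrivial (F.obj X)

lemma IsExactSequence.isTrivial_obj {f : C' ⥤ C} {F : C ⥤ D} (h : IsExactSequence f F) (X : C') :
    IsTrivial ((f ⋙ F).obj X) :=
  (h.essImage_iff _).1 (f.obj_mem_essImage X)

section
variable (k : Type w) [Field k] [IsAlgClosed k] [CategoryTheory.Linear k D] [RigidCategory D]
  [IsTensorCategory k D]

lemma exists_smul_id (c : 𝟙_ D ⟶ 𝟙_ D) : ∃ a : k, a • 𝟙 (𝟙_ D) = c :=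
  endomorphism_simple_eq_smul_id k c

/-- The map `Hom(𝟙, P) ⊗ Hom(𝟙, Q) → Hom(𝟙, P ⊗ Q)`. -/
noncomputable def homTensor (P Q : D) : ((𝟙_ D ⟶ P) ⊗[k] (𝟙_ D ⟶ Q)) →ₗ[k] (𝟙_ D ⟶ P ⊗ Q) :=
  fiberTensor k (𝟭 D) P Q

lemma homTensor_tmul (P Q : D) (v : 𝟙_ D ⟶ P) (w : 𝟙_ D ⟶ Q) :
    homTensor k P Q (v ⊗ₜ w) = (λ_ (𝟙_ D)).inv ≫ (v ⊗ₘ w) := by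
  refine (fiberTensor_tmul k (𝟭 D) P Q v w).trans ?_
  simp

lemma bijective_homTensor {P : D} (hP : IsTrivial P) (Q : D) :
    Function.Bijective (homTensor k P Q) := by
  obtain ⟨n, ⟨e⟩⟩ := hP
  let i (j : Fin n) : 𝟙_ D ⟶ P := biproduct.ι (fun _ : Fin n => 𝟙_ D) j ≫ e.inv
  let p (j : Fin n) : P ⟶ 𝟙_ D := e.hom ≫ biproduct.π (fun _ : Fin n => 𝟙_ D) j
  have hip : ∑ j, p j ≫ i j = 𝟙 P := by
    rw [← e.hom_inv_id, ← Category.id_comp e.inv,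
      ← biproduct.total (f := fun _ : Fin n => 𝟙_ D), Preadditive.sum_comp, Preadditive.comp_sum]
    simp only [i, p, Category.assoc]
  let inv : (𝟙_ D ⟶ P ⊗ Q) → ((𝟙_ D ⟶ P) ⊗[k] (𝟙_ D ⟶ Q)) :=
    fun h => ∑ j, i j ⊗ₜ (h ≫ p j ▷ Q ≫ (λ_ Q).hom)
  have hadd : ∀ a b, inv (a + b) = inv a + inv b := fun a b => by
    simp [inv, TensorProduct.tmul_add, Finset.sum_add_distrib]
  refine Function.bijective_iff_has_inverse.2 ⟨inv, ?_, ?_⟩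
  · intro z
    induction z using TensorProduct.induction_on with
    | zero => simp [inv]
    | add a b ha hb => rw [map_add, hadd, ha, hb]
    | tmul v w =>
      choose c hc using fun j => exists_smul_id k (v ≫ p j)
      have hv : v = ∑ j, c j • i j := by
        conv_lhs => rw [← Category.comp_id v, ← hip, Preadditive.comp_sum]
        refine Finset.sum_congr rfl fun j _ => ?_
        rw [← Category.assoc, ← hc j]
        simp
      have h1 (j : Fin n) : homTensor k P Q (v ⊗ₜ w) ≫ p j ▷ Q ≫ (λ_ Q).hom = c j • w := by
        rw [homTensor_tmul, MonoidalCategory.tensorHom_def', Category.assoc, Category.assoc,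
          ← comp_whiskerRight_assoc, ← hc j]
        simp [MonoidalLinear.smul_whiskerRight]
      simp only [inv, h1]
      conv_rhs => rw [hv]
      simp [TensorProduct.sum_tmul, TensorProduct.smul_tmul]
  · intro h
    simp only [inv, map_sum, homTensor_tmul]
    have h1 (j : Fin n) : (λ_ (𝟙_ D)).inv ≫ (i j ⊗ₘ (h ≫ p j ▷ Q ≫ (λ_ Q).hom)) =
        h ≫ (p j ≫ i j) ▷ Q := by
      rw [MonoidalCategory.tensorHom_def']
      simp
    simp only [h1]
    rw [← Preadditive.comp_sum, ← sum_whiskerRight, hip]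
    simp

lemma hasStrongFiber [MonoidalCategory C'] (Φ : C' ⥤ D) [Φ.Monoidal]
    (h : ∀ X, IsTrivial (Φ.obj X)) : HasStrongFiber k Φ where
  bijective_fiberTensor X Y := by
    have h1 : (fiberTensor k Φ X Y : _ → _) =
        (fun t : 𝟙_ D ⟶ Φ.obj X ⊗ Φ.obj Y => t ≫ Functor.LaxMonoidal.μ Φ X Y) ∘
          homTensor k (Φ.obj X) (Φ.obj Y) := by
      have h2 : fiberTensor k Φ X Y =
          CategoryTheory.Linear.rightComp k _ (Functor.LaxMonoidal.μ Φ X Y) ∘ₗ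
            homTensor k (Φ.obj X) (Φ.obj Y) := by
        refine TensorProduct.ext' fun v w => ?_
        rw [fiberTensor_tmul, LinearMap.comp_apply, homTensor_tmul]
        simp
      rw [h2]
      rfl
    rw [h1]
    refine Function.Bijective.comp ?_ (bijective_homTensor k (h X) _)
    exact ((Functor.Monoidal.μIso Φ X Y).homToEquiv).bijective
  bijective_fiberUnit := by
    have hε : (Functor.LaxMonoidal.ε Φ : 𝟙_ D ⟶ Φ.obj (𝟙_ C')) ≠ 0 := fun h0 => by
      have h1 := Functor.Monoidal.ε_η Φ
      rw [h0, zero_comp] at h1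
      exact id_nonzero (𝟙_ D) h1.symm
    refine ⟨?_, fun v => ?_⟩
    · rw [← LinearMap.ker_eq_bot]
      exact LinearMap.ker_toSpanSingleton k hε
    · obtain ⟨a, ha⟩ := exists_smul_id k (v ≫ Functor.OplaxMonoidal.η Φ)
      refine ⟨a, ?_⟩
      have h1 := congrArg (fun t => t ≫ Functor.LaxMonoidal.ε Φ) ha
      simpa [fiberUnit] using h1

variable [MonoidalCategory C] [MonoidalCategory C'] {f : C' ⥤ C} {F : C ⥤ D} [f.Monoidal]
  [F.Monoidal]

/-- The induced Hopf algebra of an exact sequence `C' ⟶ C ⟶ D`: the coend of the functor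
`ω = Hom(𝟙, F f -)`. Of its structure only the multiplication and unit, on which finite
dimension and commutativity depend, are recorded below. -/
def InducedHopfAlgebra (_ : IsExactSequence f F) : Type (max u₃ w v₂) := Coend k (f ⋙ F)

variable (h : IsExactSequence f F)

noncomputable instance : Ring (InducedHopfAlgebra k h) :=
  letI := hasStrongFiber k (f ⋙ F) h.isTrivial_obj
  coendRing k (f ⋙ F)

noncomputable instance : Algebra k (InducedHopfAlgebra k h) :=
  letI := hasStrongFiber k (f ⋙ F) h.isTrivial_obj
  coendAlgebra k (f ⋙ F)

/-- The exact sequence is abelian: its induced Hopf algebra is finite dimensional and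
commutative. -/
def IsExactSequence.IsAbelian : Prop :=
  Module.Finite k (InducedHopfAlgebra k h) ∧ ∀ x y : InducedHopfAlgebra k h, x * y = y * x

end
end Tensor

end TensorCat

/-! Write `A = R 𝟙`, with counit `ε : F A ⟶ 𝟙` and half-braiding `σ`. Conditions (i) and (ii) are
equivalent in any braided category: if `c² = id`, the hexagons kill the double braiding of `A ⊗ A`
with `A`; conversely, inserting the unit into the second factor of `A ⊗ A` turns the dyslectic
identity into `c² = id`.

The link with (iii) is the space `V = Hom(𝟙, F A)` with the product induced by `A`. Normality forces
`F A` to be trivial (`isTrivial_map_rightAdjoint_unit`), so `A` comes from `C'`. By the adjunction,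
`X ⟶ A` is the same as a functional on `ω(X)`. Hence `A` represents `X ↦ ω(X)^*` on `C'`, and
co-Yoneda identifies the coend `H` with `V` (`bijective_coendToFiber`), compatibly with products
(`coendToFiber_mul`). Thus `H` is always finite dimensional, and it is commutative exactly when `V`
is.

It remains to compare `σ² = id` on `A ⊗ A` with commutativity of `V`. As `F A` is trivial, `F (A ⊗
A)` is controlled by the pairs `v ⊗ w` of elements of `V`. Either condition implies that `F σ` is
the flip `v ⊗ w ↦ w ⊗ v`. Given `σ² = id`, the identity `σ m = m` then yields `vw = wv`
(`fiberMul_comm_of_sigma_sigma`); given commutativity, the flip squares to the identity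
(`sigma_sigma_of_comm`). -/

namespace TensorCat

/-! ### Symmetric objects and dyslectic free modules -/

section Dyslectic

variable {B : Type u} [Category.{v} B] [MonoidalCategory B] [BraidedCategory B]

lemma freeRightModule_isDyslectic_of_isSymmetricObject {A : B} [MonObj A]
    (h : IsSymmetricObject A) : (freeRightModule A A).IsDyslectic := by
  have h' : (β_ A A).hom ≫ (β_ A A).hom = 𝟙 (A ⊗ A) := h
  -- By the hexagons, the double braiding is built from two copies of `c²`, one nested inside the
  -- other.
  have h1 : (β_ (A ⊗ A) A).hom ≫ (β_ A (A ⊗ A)).hom = 𝟙 _ := by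
    rw [BraidedCategory.braiding_tensor_left_hom, BraidedCategory.braiding_tensor_right_hom]
    simp only [Category.assoc, Iso.hom_inv_id_assoc]
    rw [← comp_whiskerRight_assoc, h']
    simp only [id_whiskerRight, Category.id_comp, Iso.inv_hom_id_assoc]
    rw [← MonoidalCategory.whiskerLeft_comp_assoc, h']
    simp
  change (β_ (A ⊗ A) A).hom ≫ (β_ A (A ⊗ A)).hom ≫ (freeRightModule A A).act = _
  exact (Category.assoc _ _ _).symm.trans
    ((congrArg (fun t => t ≫ (freeRightModule A A).act) h1).trans (Category.id_comp _))

lemma isSymmetricObject_of_freeRightModule_isDyslectic {A : B} [MonObj A]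
    (h : (freeRightModule A A).IsDyslectic) : IsSymmetricObject A := by
  have h0 : (β_ (A ⊗ A) A).hom ≫ (β_ A (A ⊗ A)).hom ≫ (α_ A A A).hom ≫ A ◁ MonObj.mul =
      (α_ A A A).hom ≫ A ◁ MonObj.mul := h
  have hu : (A ◁ MonObj.one) ▷ A ≫ (α_ A A A).hom ≫ A ◁ MonObj.mul = (ρ_ A).hom ▷ A := by
    rw [associator_naturality_middle_assoc, ← MonoidalCategory.whiskerLeft_comp, MonObj.one_mul]
    simp
  -- The unit enters the second factor of `A ⊗ A`. By naturality it passes both braidings, and the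
  -- action then absorbs it by `hu`.
  have h2 := congrArg (fun t => (ρ_ A).inv ▷ A ≫ (A ◁ MonObj.one) ▷ A ≫ t) h0
  simp only [hu, BraidedCategory.braiding_naturality_left_assoc,
    BraidedCategory.braiding_naturality_right_assoc, inv_hom_whiskerRight] at h2
  simpa [IsSymmetricObject] using h2

end Dyslectic

/-! ### Trivial objects -/

section Trivial

attribute [local instance] Abelian.hasFiniteBiproducts

variable {D : Type u₂} [Category.{v₂} D] [Abelian D] [MonoidalCategory D]

/-- The form in which triviality is used below: it survives applying additive functors and
whiskering. -/
lemma IsTrivial.exists_total {P : D} (hP : IsTrivial P) :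
    ∃ (n : ℕ) (i : Fin n → (𝟙_ D ⟶ P)) (p : Fin n → (P ⟶ 𝟙_ D)), ∑ j, p j ≫ i j = 𝟙 P := by
  obtain ⟨n, ⟨e⟩⟩ := hP
  refine ⟨n, fun j => biproduct.ι (fun _ : Fin n => 𝟙_ D) j ≫ e.inv,
    fun j => e.hom ≫ biproduct.π (fun _ : Fin n => 𝟙_ D) j, ?_⟩
  have h := congrArg (fun t => e.hom ≫ t ≫ e.inv) (biproduct.total (f := fun _ : Fin n => 𝟙_ D))
  simpa [Preadditive.sum_comp, Preadditive.comp_sum, -biproduct.total] using h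

/-- Morphisms out of a trivial object are determined by their composites with `𝟙 ⟶ P`. -/
lemma IsTrivial.hom_ext {P Q : D} (hP : IsTrivial P) {a b : P ⟶ Q}
    (h : ∀ v : 𝟙_ D ⟶ P, v ≫ a = v ≫ b) : a = b := by
  obtain ⟨n, i, p, hip⟩ := hP.exists_total
  rw [← Category.id_comp a, ← Category.id_comp b, ← hip, Preadditive.sum_comp,
    Preadditive.sum_comp]
  simp only [Category.assoc, h]

section
variable (k : Type w) [Field k] [IsAlgClosed k] [CategoryTheory.Linear k D] [RigidCategory D]
  [IsTensorCategory k D]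

/-- `End(𝟙) = k`. -/
noncomputable def unitScalar : (𝟙_ D ⟶ 𝟙_ D) ≃ₗ[k] k :=
  (LinearEquiv.ofBijective (LinearMap.toSpanSingleton k (𝟙_ D ⟶ 𝟙_ D) (𝟙 (𝟙_ D)))
    ⟨by rw [← LinearMap.ker_eq_bot]
        exact LinearMap.ker_toSpanSingleton k (id_nonzero (𝟙_ D)),
      fun c => exists_smul_id k c⟩).symm

lemma unitScalar_smul (c : 𝟙_ D ⟶ 𝟙_ D) : unitScalar k c • 𝟙 (𝟙_ D) = c :=
  (unitScalar (D := D) k).symm_apply_apply c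

lemma unitScalar_smul_comp (c : 𝟙_ D ⟶ 𝟙_ D) {P : D} (v : 𝟙_ D ⟶ P) :
    unitScalar k c • v = c ≫ v := by
  conv_rhs => rw [← unitScalar_smul k c]
  simp

end

/-- The `i j` span `Hom(𝟙, P)` but may be dependent. Replacing them by a basis, with the `p j`
recombined accordingly, gives mutually inverse maps between `P` and a power of `𝟙`. -/
lemma isTrivial_of_total (k : Type w) [Field k] [IsAlgClosed k] [CategoryTheory.Linear k D]
    [RigidCategory D] [IsTensorCategory k D] {P : D} {ι : Type*} [Fintype ι] (i : ι → (𝟙_ D ⟶ P))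
    (p : ι → (P ⟶ 𝟙_ D)) (hip : ∑ j, p j ≫ i j = 𝟙 P) : IsTrivial P := by
  let b := Module.finBasis k (𝟙_ D ⟶ P)
  -- `q a` is chosen to induce the coordinate functional `b.coord a` on `Hom(𝟙, P)`, as `hq` checks.
  let q (a : Fin _) : P ⟶ 𝟙_ D := ∑ j, b.coord a (i j) • p j
  have hq (v : 𝟙_ D ⟶ P) (a) : v ≫ q a = b.coord a v • 𝟙 _ := by
    have hv : v = ∑ j, unitScalar k (v ≫ p j) • i j := by
      simp only [unitScalar_smul_comp, Category.assoc]
      rw [← Preadditive.comp_sum, hip, Category.comp_id]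
    conv_rhs => rw [hv, map_sum, Finset.sum_smul]
    simp only [q, Preadditive.comp_sum, Linear.comp_smul, map_smul]
    refine Finset.sum_congr rfl fun j _ => ?_
    rw [smul_assoc, smul_comm, unitScalar_smul]
  have htot : ∑ a, q a ≫ b a = 𝟙 P := by
    simp only [q, Preadditive.sum_comp]
    rw [Finset.sum_comm, ← hip]
    refine Finset.sum_congr rfl fun j _ => ?_
    simp only [Linear.smul_comp, ← Linear.comp_smul]
    rw [← Preadditive.comp_sum]
    congr 1
    exact b.sum_repr (i j)
  refine ⟨_, ⟨biproduct.lift q, biproduct.desc b, ?_, ?_⟩⟩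
  · rw [biproduct.lift_desc, htot]
  · ext a a'
    simp only [Category.assoc, biproduct.lift_π, biproduct.ι_desc_assoc, hq,
      Module.Basis.coord_apply, Module.Basis.repr_self]
    rw [Category.id_comp, biproduct.ι_π, Finsupp.single_apply]
    split_ifs <;> simp

lemma isTrivial_unit (k : Type w) [Field k] [IsAlgClosed k] [CategoryTheory.Linear k D]
    [RigidCategory D] [IsTensorCategory k D] : IsTrivial (𝟙_ D) :=
  isTrivial_of_total k (fun _ : Unit => 𝟙 _) (fun _ => 𝟙 _) (by simp)

lemma IsTrivial.of_retract (k : Type w) [Field k] [IsAlgClosed k] [CategoryTheory.Linear k D]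
    [RigidCategory D] [IsTensorCategory k D] {P Q : D} (hQ : IsTrivial Q) (s : P ⟶ Q) (r : Q ⟶ P)
    (h : s ≫ r = 𝟙 P) : IsTrivial P := by
  obtain ⟨n, i, p, hip⟩ := hQ.exists_total
  refine isTrivial_of_total k (fun j => i j ≫ r) (fun j => s ≫ p j) ?_
  have := congrArg (fun t => s ≫ t ≫ r) hip
  simpa [Preadditive.sum_comp, Preadditive.comp_sum, h] using this

/-- A composite through `𝟙` is a tensor product of its two halves, by interchange. This lets
transposed maps be recombined under a duality. -/
lemma comp_eq_whisker {E : Type u} [Category.{v} E] [MonoidalCategory E] {P : E}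
    (s : P ⟶ 𝟙_ E) (t : 𝟙_ E ⟶ P) :
    s ≫ t = (λ_ P).inv ≫ t ▷ P ≫ P ◁ s ≫ (ρ_ P).hom := by
  rw [← whisker_exchange_assoc, rightUnitor_naturality, ← leftUnitor_inv_naturality_assoc]
  rw [← unitors_equal, Iso.inv_hom_id_assoc]

-- Transposing a decomposition of `𝟙 Q` decomposes `𝟙 P`: the sum reassembles into one side of the
-- zigzag identity.
open ExactPairing in
lemma IsTrivial.of_exactPairing (k : Type w) [Field k] [IsAlgClosed k] [CategoryTheory.Linear k D]
    [RigidCategory D] [IsTensorCategory k D] {P Q : D} [ExactPairing P Q] (hQ : IsTrivial Q) :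
    IsTrivial P := by
  have := IsTensorCategory.toMonoidalPreadditive k (C := D)
  obtain ⟨n, i, p, hip⟩ := hQ.exists_total
  refine isTrivial_of_total k (fun j => coevaluation P Q ≫ P ◁ p j ≫ (ρ_ P).hom)
    (fun j => (λ_ P).inv ≫ i j ▷ P ≫ evaluation P Q) ?_
  have h1 (j : Fin n) : ((λ_ P).inv ≫ i j ▷ P ≫ evaluation P Q) ≫
      coevaluation P Q ≫ P ◁ p j ≫ (ρ_ P).hom =
      (λ_ P).inv ≫ coevaluation P Q ▷ P ≫ (α_ _ _ _).hom ≫ P ◁ ((p j ≫ i j) ▷ P) ≫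
        P ◁ evaluation P Q ≫ (ρ_ P).hom := by
    rw [comp_eq_whisker]
    simp
  simp only [h1]
  rw [← Preadditive.comp_sum]
  simp only [← Preadditive.comp_sum, ← Preadditive.sum_comp]
  rw [← whiskerLeft_sum, ← sum_whiskerRight, hip]
  have := evaluation_coevaluation P Q
  simp [reassoc_of% this]

section
variable (k : Type w) [Field k] [IsAlgClosed k] [CategoryTheory.Linear k D] [RigidCategory D]
  [IsTensorCategory k D]

/-- For trivial `P`, `Hom(P, 𝟙)` is the dual of `Hom(𝟙, P)`. -/
noncomputable def homUnitDual (P : D) : (P ⟶ 𝟙_ D) →ₗ[k] Module.Dual k (𝟙_ D ⟶ P) :=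
  LinearMap.mk₂ k (fun u v => unitScalar k (v ≫ u)) (by simp) (by simp) (by simp) (by simp)

lemma homUnitDual_apply {P : D} (u : P ⟶ 𝟙_ D) (v : 𝟙_ D ⟶ P) :
    homUnitDual k P u v = unitScalar k (v ≫ u) := rfl

/-- Elements of `Hom(𝟙, P)` separate morphisms out of `P`, which gives injectivity; a functional `φ`
is induced by `∑ j, φ (i j) • p j`. -/
lemma IsTrivial.bijective_homUnitDual {P : D} (hP : IsTrivial P) :
    Function.Bijective (homUnitDual k P) := by
  refine ⟨fun u u' h => hP.hom_ext fun v => ?_, fun φ => ?_⟩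
  · exact (unitScalar k).injective (LinearMap.congr_fun h v)
  · obtain ⟨n, i, p, hip⟩ := hP.exists_total
    refine ⟨∑ j, φ (i j) • p j, LinearMap.ext fun v => ?_⟩
    have hv : v = ∑ j, unitScalar k (v ≫ p j) • i j := by
      simp only [unitScalar_smul_comp, Category.assoc]
      rw [← Preadditive.comp_sum, hip, Category.comp_id]
    conv_rhs => rw [hv]
    simp [homUnitDual_apply, mul_comm]

end

end Trivial

/-! ### Normality and the triviality of `F (R 𝟙)` -/

section Normal

open Functor.LaxMonoidal Functor.OplaxMonoidal Functor.Monoidal ExactPairing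
attribute [local instance] Abelian.hasFiniteBiproducts

/-- A morphism `P ⟶ 𝟙` is recovered from its transpose `𝟙 ⟶ Q`. -/
lemma eq_of_exactPairing {D : Type u₂} [Category.{v₂} D] [MonoidalCategory D] {P Q : D}
    [ExactPairing P Q] (u : P ⟶ 𝟙_ D) :
    u = (λ_ _).inv ≫ (coevaluation P Q ≫ u ▷ Q ≫ (λ_ Q).hom) ▷ P ≫ evaluation P Q := by
  have h1 := congrArg (fun t => (λ_ _).inv ≫ t ≫ (ρ_ _).hom ≫ u) (evaluation_coevaluation P Q)
  simp only [Category.assoc, Iso.inv_hom_id_assoc] at h1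
  -- Insert the zigzag in front of `u`, then slide `u` past the evaluation.
  conv_lhs => rw [← h1, ← rightUnitor_naturality, whisker_exchange_assoc, ← unitors_equal,
      leftUnitor_naturality]
  simp

variable {C : Type u₁} [Category.{v₁} C] [MonoidalCategory C] [RigidCategory C]
  {D : Type u₂} [Category.{v₂} D] [Abelian D] [MonoidalCategory D]

/-- If `F` is normal, every morphism `F X ⟶ 𝟙` factors through `F q` for some `q : X ⟶ Z` with
`F Z` trivial. -/
lemma IsNormal.exists_factor (k : Type w) [Field k] [IsAlgClosed k] [CategoryTheory.Linear k D]
    [RigidCategory D] [IsTensorCategory k D] {F : C ⥤ D} [F.Monoidal] (hF : IsNormal F) (X : C)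
    (u : F.obj X ⟶ 𝟙_ D) :
    ∃ (Z : C) (q : X ⟶ Z) (u' : F.obj Z ⟶ 𝟙_ D), IsTrivial (F.obj Z) ∧ u = F.map q ≫ u' := by
  have := IsTensorCategory.toMonoidalPreadditive k (C := D)
  -- Normality concerns subobjects, so it is applied to the dual of `X`, where `u` becomes a
  -- morphism `û` out of `𝟙`.
  obtain ⟨X₀, i, -, -, hX₀, hmax⟩ := hF (Xᘁ)
  let _ := mapPairing F X (Xᘁ)
  let _ := mapPairing F (ᘁX₀) X₀
  let û : 𝟙_ D ⟶ F.obj (Xᘁ) := coevaluation (F.obj X) (F.obj (Xᘁ)) ≫ u ▷ _ ≫ (λ_ _).hom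
  have hû : ∃ g : 𝟙_ D ⟶ F.obj X₀, g ≫ F.map i = û := by
    by_cases h0 : û = 0
    · exact ⟨0, by rw [h0, zero_comp]⟩
    -- A nonzero `û` is mono because `𝟙` is simple, so it is a trivial subobject.
    · have := IsTensorCategory.simple_unit k (C := D)
      exact hmax _ û (mono_of_nonzero_from_simple h0) (isTrivial_unit k)
  obtain ⟨g, hg⟩ := hû
  have hu : u = (λ_ _).inv ≫ û ▷ F.obj X ≫ evaluation (F.obj X) (F.obj (Xᘁ)) := eq_of_exactPairing u
  -- `q` is the transpose of `i : X₀ ⟶ Xᘁ`; `hq` is its defining property.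
  let q : X ⟶ ᘁX₀ := (λ_ X).inv ≫ coevaluation (ᘁX₀) X₀ ▷ X ≫ (α_ _ _ _).hom ≫
    (ᘁX₀) ◁ (i ▷ X ≫ evaluation X (Xᘁ)) ≫ (ρ_ _).hom
  have hq : X₀ ◁ q ≫ evaluation (ᘁX₀) X₀ = i ▷ X ≫ evaluation X (Xᘁ) := by
    have h1 := (tensorLeftHomEquiv X (ᘁX₀) X₀ (𝟙_ C)).symm_apply_apply
      (i ▷ X ≫ evaluation X (Xᘁ))
    have h2 : tensorLeftHomEquiv X (ᘁX₀) X₀ (𝟙_ C) (i ▷ X ≫ evaluation X (Xᘁ)) =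
        q ≫ (ρ_ _).inv := by
      simp [q, tensorLeftHomEquiv]
    rw [h2] at h1
    rw [← h1]
    simp [tensorLeftHomEquiv, unitors_equal]
  refine ⟨ᘁX₀, q, (λ_ _).inv ≫ g ▷ _ ≫ evaluation (F.obj (ᘁX₀)) (F.obj X₀),
    hX₀.of_exactPairing k, ?_⟩
  have e1 : evaluation (F.obj X) (F.obj (Xᘁ)) = μ F _ _ ≫ F.map (evaluation X (Xᘁ)) ≫ η F := rfl
  have e2 : evaluation (F.obj (ᘁX₀)) (F.obj X₀) =
    μ F _ _ ≫ F.map (evaluation (ᘁX₀) X₀) ≫ η F := rfl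
  rw [hu, ← hg, e1, e2, comp_whiskerRight, Category.assoc, μ_natural_left_assoc,
    ← Functor.map_comp_assoc, ← hq, leftUnitor_inv_naturality_assoc, whisker_exchange_assoc,
    μ_natural_right_assoc, Functor.map_comp_assoc]

/-- The counit `F (R 𝟙) ⟶ 𝟙` factors through `F q` for some `q : R 𝟙 ⟶ Z` with `F Z` trivial. Since
the counit is adjoint to the identity, `q` is split mono, and `F (R 𝟙)` is a retract of `F Z`. -/
lemma isTrivial_map_rightAdjoint_unit {F : C ⥤ D} [F.Monoidal] {R : D ⥤ C} (adj : F ⊣ R) (k : Type w) [Field k] [IsAlgClosed k]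
    [CategoryTheory.Linear k D] [RigidCategory D] [IsTensorCategory k D] (hF : IsNormal F) :
    IsTrivial (F.obj (R.obj (𝟙_ D))) := by
  obtain ⟨Z, q, u', hZ, h⟩ := hF.exists_factor k _ (counitUnit adj)
  refine hZ.of_retract k (F.map q) (F.map (adj.homEquiv _ _ u')) ?_
  rw [← Functor.map_comp, ← adj.homEquiv_naturality_left, ← h, counitUnit,
    ← adj.homEquiv_symm_id, Equiv.apply_symm_apply, CategoryTheory.Functor.map_id]

end Normal

/-! ### Calculus of the counit and of pairs of elements -/

section Unit

open Functor.LaxMonoidal Functor.OplaxMonoidal Functor.Monoidal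

section

variable {C : Type u₁} [Category.{v₁} C] {D : Type u₂} [Category.{v₂} D] [MonoidalCategory D]
  {F : C ⥤ D} {R : D ⥤ C} (adj : F ⊣ R)

lemma map_homEquiv_counitUnit {X : C} (u : F.obj X ⟶ 𝟙_ D) :
    F.map (adj.homEquiv _ _ u) ≫ counitUnit adj = u := by
  rw [counitUnit, ← Adjunction.homEquiv_counit, Equiv.symm_apply_apply]

/-- Injectivity of the adjunction bijection: equations between morphisms into `R 𝟙` may be tested
after the counit. -/
lemma hom_ext_counitUnit {X : C} {g h : X ⟶ R.obj (𝟙_ D)}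
    (w : F.map g ≫ counitUnit adj = F.map h ≫ counitUnit adj) : g = h := by
  apply (adj.homEquiv _ _).symm.injective
  rwa [Adjunction.homEquiv_counit, Adjunction.homEquiv_counit]

end

variable {C : Type u₁} [Category.{v₁} C] [MonoidalCategory C]
  {D : Type u₂} [Category.{v₂} D] [MonoidalCategory D]
  {F : C ⥤ D} [F.Monoidal] {R : D ⥤ C} (adj : F ⊣ R)

/-- Both sides are `ε ⊗ ε`, as the counit is multiplicative. The same holds for `projR`, so the two
projections agree after `ε`. -/
lemma projL_counitUnit :
    projL adj (R.obj (𝟙_ D)) ≫ counitUnit adj =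
      F.map (rightAdjointMonObj adj).mul ≫ counitUnit adj := by
  rw [map_mul_counit, projL, MonoidalCategory.tensorHom_def']
  simp [unitors_equal]

lemma projR_counitUnit :
    projR adj (R.obj (𝟙_ D)) ≫ counitUnit adj =
      F.map (rightAdjointMonObj adj).mul ≫ counitUnit adj := by
  rw [map_mul_counit, projR, MonoidalCategory.tensorHom_def]
  simp

/-- The canonical isomorphism `X ⊗ R 𝟙 ⟶ R (F X)` followed by `R u` multiplies the morphism
`X ⟶ R 𝟙` adjoint to `u` with `R 𝟙`. -/
lemma hopfL_map {X : C} (u : F.obj X ⟶ 𝟙_ D) :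
    hopfL adj X ≫ R.map u = adj.homEquiv _ _ u ▷ _ ≫ (rightAdjointMonObj adj).mul := by
  apply hom_ext_counitUnit adj
  rw [hopfL, ← adj.homEquiv_naturality_right, map_homEquiv_counitUnit, Functor.map_comp,
    Category.assoc, ← projL_counitUnit, ← Category.assoc, projL_naturality, Category.assoc,
    map_homEquiv_counitUnit]

/-- The morphism `𝟙 ⟶ F (X ⊗ Y)` formed from `𝟙 ⟶ F X` and `𝟙 ⟶ F Y`. -/
def fiberPair (F : C ⥤ D) [F.Monoidal] {X Y : C} (v : 𝟙_ D ⟶ F.obj X) (w : 𝟙_ D ⟶ F.obj Y) :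
    𝟙_ D ⟶ F.obj (X ⊗ Y) :=
  (λ_ (𝟙_ D)).inv ≫ (v ⊗ₘ w) ≫ μ F X Y

lemma fiberPair_whiskerRight {X X' Y : C} (v : 𝟙_ D ⟶ F.obj X) (w : 𝟙_ D ⟶ F.obj Y)
    (g : X ⟶ X') : fiberPair F v w ≫ F.map (g ▷ Y) = fiberPair F (v ≫ F.map g) w := by
  simp [fiberPair, MonoidalCategory.tensorHom_def']

lemma fiberPair_whiskerLeft {X Y Y' : C} (v : 𝟙_ D ⟶ F.obj X) (w : 𝟙_ D ⟶ F.obj Y)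
    (g : Y ⟶ Y') : fiberPair F v w ≫ F.map (X ◁ g) = fiberPair F v (w ≫ F.map g) := by
  simp [fiberPair, MonoidalCategory.tensorHom_def]

/-- `projL` contracts the second factor with the counit, leaving a scalar multiple of `v`. -/
lemma fiberPair_projL {X : C} (v : 𝟙_ D ⟶ F.obj X) (w : 𝟙_ D ⟶ F.obj (R.obj (𝟙_ D))) :
    fiberPair F v w ≫ projL adj X = (w ≫ counitUnit adj) ≫ v := by
  simp only [fiberPair, projL, Category.assoc, μ_δ_assoc]
  rw [tensorHom_def'_assoc, ← whisker_exchange_assoc, rightUnitor_naturality,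
    ← MonoidalCategory.whiskerLeft_comp_assoc, ← unitors_equal, leftUnitor_naturality_assoc,
    Iso.inv_hom_id_assoc, Category.assoc]

lemma fiberPair_projR {X : C} (v : 𝟙_ D ⟶ F.obj (R.obj (𝟙_ D))) (w : 𝟙_ D ⟶ F.obj X) :
    fiberPair F v w ≫ projR adj X = (v ≫ counitUnit adj) ≫ w := by
  simp only [fiberPair, projR, Category.assoc, μ_δ_assoc]
  rw [tensorHom_def_assoc, whisker_exchange_assoc, leftUnitor_naturality,
    ← comp_whiskerRight_assoc, unitors_equal, rightUnitor_naturality_assoc,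
    unitors_inv_equal, Iso.inv_hom_id_assoc, Category.assoc]

/-- The product on `Hom(𝟙, F (R 𝟙))` induced by the algebra structure of `R 𝟙`. -/
def fiberMul (v w : 𝟙_ D ⟶ F.obj (R.obj (𝟙_ D))) : 𝟙_ D ⟶ F.obj (R.obj (𝟙_ D)) :=
  fiberPair F v w ≫ F.map (rightAdjointMonObj adj).mul

lemma fiberPair_map_mul_counitUnit {X Y : C} (v : 𝟙_ D ⟶ F.obj X) (w : 𝟙_ D ⟶ F.obj Y)
    (g : X ⟶ R.obj (𝟙_ D)) (g' : Y ⟶ R.obj (𝟙_ D)) :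
    fiberPair F v w ≫ F.map ((g ⊗ₘ g') ≫ (rightAdjointMonObj adj).mul) ≫ counitUnit adj =
      (v ≫ F.map g ≫ counitUnit adj) ≫ w ≫ F.map g' ≫ counitUnit adj := by
  rw [MonoidalCategory.tensorHom_def, Functor.map_comp_assoc, Functor.map_comp_assoc,
    ← Category.assoc, fiberPair_whiskerRight, ← Category.assoc, fiberPair_whiskerLeft,
    ← projR_counitUnit, ← Category.assoc, fiberPair_projR]
  simp only [Category.assoc]

variable [RigidCategory C]

/-- The algebra `R 𝟙` is commutative with respect to its half-braiding. -/
lemma sigma_mul : (sigma adj (R.obj (𝟙_ D))).hom ≫ (rightAdjointMonObj adj).mul =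
    (rightAdjointMonObj adj).mul := by
  apply hom_ext_counitUnit adj
  -- `σ` carries `projL` to `projR`, and these have the same composite with the counit.
  rw [Functor.map_comp, Category.assoc, ← projL_counitUnit, ← Category.assoc, sigma_spec,
    projR_counitUnit, projL_counitUnit]

lemma sigma_naturality {X Y : C} (g : X ⟶ Y) :
    (R.obj (𝟙_ D)) ◁ g ≫ (sigma adj Y).hom = (sigma adj X).hom ≫ g ▷ (R.obj (𝟙_ D)) :=
  (halfBraiding adj).naturality g

end Unit

/-! ### Symmetry of the half-braiding and commutativity on elements -/

section Symmetric

open Functor.LaxMonoidal Functor.OplaxMonoidal Functor.Monoidal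

section

variable {C : Type u₁} [Category.{v₁} C] [MonoidalCategory C]
  {D : Type u₂} [Category.{v₂} D] [Abelian D] [MonoidalCategory D]
  {F : C ⥤ D} [F.Monoidal]

/-- The pairs `v ⊗ w` are jointly epimorphic. -/
lemma IsTrivial.hom_ext_fiberPair [MonoidalPreadditive D] {X Y : C} (hX : IsTrivial (F.obj X))
    (hY : IsTrivial (F.obj Y)) {Q : D} {a b : F.obj (X ⊗ Y) ⟶ Q}
    (h : ∀ v w, fiberPair F v w ≫ a = fiberPair F v w ≫ b) : a = b := by
  obtain ⟨n, i, p, hip⟩ := hX.exists_total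
  obtain ⟨n', i', p', hip'⟩ := hY.exists_total
  rw [← cancel_epi (μ F X Y), ← Category.id_comp (μ F X Y), ← id_tensorHom_id, ← hip, ← hip',
    sum_tensor]
  simp only [tensor_sum, Preadditive.sum_comp]
  refine Finset.sum_congr rfl fun j _ => Finset.sum_congr rfl fun j' _ => ?_
  -- Each summand `(p j ⊗ₘ p' j') ≫ (i j ⊗ₘ i' j')` passes through the pair of `i j` and `i' j'`.
  have h1 := congrArg (fun t => (p j ⊗ₘ p' j') ≫ (λ_ (𝟙_ D)).hom ≫ t) (h (i j) (i' j'))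
  simpa [fiberPair] using h1

/-- If `F (R 𝟙)` is trivial, a morphism into `F (R 𝟙 ⊗ R 𝟙)` is determined by its composites with
the morphisms `φ ⊗ id`, for `φ : F (R 𝟙) ⟶ 𝟙`. -/
lemma IsTrivial.hom_ext_projR [MonoidalPreadditive D] {R : D ⥤ C} (adj : F ⊣ R)
    (hA : IsTrivial (F.obj (R.obj (𝟙_ D)))) {P : D}
    {a b : P ⟶ F.obj (R.obj (𝟙_ D) ⊗ R.obj (𝟙_ D))}
    (h : ∀ g : R.obj (𝟙_ D) ⟶ R.obj (𝟙_ D), a ≫ F.map (g ▷ _) ≫ projR adj _ =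
      b ≫ F.map (g ▷ _) ≫ projR adj _) : a = b := by
  obtain ⟨n, i, p, hip⟩ := hA.exists_total
  rw [← cancel_mono (δ F _ _), ← Category.comp_id (δ F _ _), ← id_whiskerRight, ← hip,
    sum_whiskerRight]
  simp only [Preadditive.comp_sum]
  refine Finset.sum_congr rfl fun j _ => ?_
  have h1 (g : R.obj (𝟙_ D) ⟶ R.obj (𝟙_ D)) : F.map (g ▷ _) ≫ projR adj (R.obj (𝟙_ D)) =
      δ F _ _ ≫ (F.map g ≫ counitUnit adj) ▷ _ ≫ (λ_ _).hom := by
    simp [projR]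
  -- Take for `g` the endomorphism of `R 𝟙` adjoint to `p j`, so that `F g` followed by the counit
  -- is `p j`.
  have h2 := congrArg (fun t => t ≫ (λ_ _).inv ≫ i j ▷ _) (h (adj.homEquiv _ _ (p j)))
  rw [h1, map_homEquiv_counitUnit] at h2
  simpa using h2

lemma fiberMul_comm_of_sigma_sigma [RigidCategory C] [MonoidalPreadditive D]
    {R : D ⥤ C} (adj : F ⊣ R) (hA : IsTrivial (F.obj (R.obj (𝟙_ D))))
    (h : (sigma adj (R.obj (𝟙_ D))).hom ≫ (sigma adj (R.obj (𝟙_ D))).hom = 𝟙 _)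
    (v w : 𝟙_ D ⟶ F.obj (R.obj (𝟙_ D))) : fiberMul adj v w = fiberMul adj w v := by
  -- In general `F σ` carries `projL` to `projR`; if `σ² = id`, it also carries `projR` back to
  -- `projL`.
  have h1 : F.map (sigma adj (R.obj (𝟙_ D))).hom ≫ projR adj _ = projL adj _ := by
    rw [← sigma_spec, ← Functor.map_comp_assoc, h, CategoryTheory.Functor.map_id,
      Category.id_comp]
  -- `F σ` is the flip: on both sides, `g` and the counit evaluate `w` to a scalar multiplying `v`.
  have h2 : fiberPair F v w ≫ F.map (sigma adj _).hom = fiberPair F w v := by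
    refine hA.hom_ext_projR adj fun g => ?_
    rw [Category.assoc, ← Functor.map_comp_assoc, ← sigma_naturality, Functor.map_comp_assoc, h1,
      ← Category.assoc, fiberPair_whiskerLeft, fiberPair_projL, ← Category.assoc,
      fiberPair_whiskerRight, fiberPair_projR]
  rw [fiberMul, fiberMul, ← h2, Category.assoc, ← Functor.map_comp, sigma_mul]

end

variable {C : Type u₁} [Category.{v₁} C] [Preadditive C] [MonoidalCategory C] [RigidCategory C]
  {D : Type u₂} [Category.{v₂} D] [Abelian D] [MonoidalCategory D]
  {F : C ⥤ D} [F.Monoidal] [F.Additive] {R : D ⥤ C} (adj : F ⊣ R)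

/-- If `F X` is trivial, a morphism into `F (X ⊗ R 𝟙)` is determined by its composites with the
morphisms `F ((g ⊗ 𝟙) m)`. -/
lemma IsTrivial.hom_ext_mul {X : C} (hX : IsTrivial (F.obj X)) {P : D}
    {a b : P ⟶ F.obj (X ⊗ R.obj (𝟙_ D))}
    (h : ∀ g : X ⟶ R.obj (𝟙_ D), a ≫ F.map (g ▷ _ ≫ (rightAdjointMonObj adj).mul) =
      b ≫ F.map (g ▷ _ ≫ (rightAdjointMonObj adj).mul)) : a = b := by
  have := adj.right_adjoint_additive
  obtain ⟨n, i, p, hip⟩ := hX.exists_total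
  -- Through `X ⊗ R 𝟙 ≅ R (F X)`, a decomposition of `𝟙 (F X)` becomes one of the identity of `R (F
  -- X)`; by `hopfL_map`, its projections are the test maps.
  rw [← cancel_mono (F.map (hopfL adj X)), ← Category.comp_id (F.map (hopfL adj X)),
    ← CategoryTheory.Functor.map_id, ← CategoryTheory.Functor.map_id, ← hip]
  simp only [Functor.map_sum, Preadditive.comp_sum]
  refine Finset.sum_congr rfl fun j _ => ?_
  have h1 := h (adj.homEquiv _ _ (p j))
  rw [← hopfL_map] at h1
  simp only [Functor.map_comp] at h1 ⊢
  simp only [reassoc_of% h1]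

/-- If the product on `Hom(𝟙, F (R 𝟙))` is commutative, then `F σ` is the flip. -/
lemma fiberPair_sigma_of_comm (hA : IsTrivial (F.obj (R.obj (𝟙_ D))))
    (h : ∀ v w, fiberMul adj v w = fiberMul adj w v) (v w : 𝟙_ D ⟶ F.obj (R.obj (𝟙_ D))) :
    fiberPair F v w ≫ F.map (sigma adj _).hom = fiberPair F w v := by
  -- Naturality moves `g` across `σ`, and `σ m = m` removes `σ`. What remains is commutativity of
  -- `v` with `w ≫ F.map g`.
  refine hA.hom_ext_mul adj fun g => ?_
  rw [Category.assoc, ← Functor.map_comp, ← Category.assoc (sigma adj _).hom, ← sigma_naturality,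
    Category.assoc, sigma_mul]
  simp only [Functor.map_comp]
  rw [← Category.assoc, ← Category.assoc, fiberPair_whiskerLeft, fiberPair_whiskerRight]
  exact h _ _

/-- After `projL`, one `σ` is absorbed into `projR`, and the other flips pairs. Contracting the
first factor of `w ⊗ v` agrees with contracting the second factor of `v ⊗ w`. -/
lemma sigma_sigma_of_comm [MonoidalPreadditive D] (hA : IsTrivial (F.obj (R.obj (𝟙_ D))))
    (h : ∀ v w, fiberMul adj v w = fiberMul adj w v) :
    (sigma adj (R.obj (𝟙_ D))).hom ≫ (sigma adj (R.obj (𝟙_ D))).hom = 𝟙 _ := by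
  apply eq_of_projL adj
  refine hA.hom_ext_fiberPair hA fun v w => ?_
  rw [Functor.map_comp, Category.assoc, sigma_spec, ← Category.assoc,
    fiberPair_sigma_of_comm adj hA h, fiberPair_projR, CategoryTheory.Functor.map_id,
    Category.id_comp, fiberPair_projL]

end Symmetric

/-! ### The coend as the algebra `Hom(𝟙, F (R 𝟙))` -/

lemma fiberTensor_tmul_comp (k : Type w) [Field k] {C' : Type u₃} [Category.{v₃} C']
    [MonoidalCategory C'] {C : Type u₁} [Category.{v₁} C] [MonoidalCategory C]
    {D : Type u₂} [Category.{v₂} D] [Preadditive D] [CategoryTheory.Linear k D]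
    [MonoidalCategory D] [MonoidalPreadditive D] [MonoidalLinear k D] {f : C' ⥤ C} [f.Monoidal]
    {F : C ⥤ D} [F.Monoidal] {X Y : C'} (v : 𝟙_ D ⟶ F.obj (f.obj X))
    (w : 𝟙_ D ⟶ F.obj (f.obj Y)) :
    fiberTensor k (f ⋙ F) X Y (v ⊗ₜ w) =
      fiberPair F v w ≫ F.map (Functor.LaxMonoidal.μ f X Y) := by
  refine (fiberTensor_tmul k (f ⋙ F) X Y v w).trans ?_
  simp [fiberPair]

section MatrixCoefficient

open Functor.LaxMonoidal Functor.OplaxMonoidal Functor.Monoidal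

variable (k : Type w) [Field k] [IsAlgClosed k]
  {C : Type u₁} [Category.{v₁} C] [Preadditive C] [CategoryTheory.Linear k C]
  {D : Type u₂} [Category.{v₂} D] [Abelian D] [CategoryTheory.Linear k D] [MonoidalCategory D]
  [RigidCategory D] [IsTensorCategory k D] {F : C ⥤ D} [F.Additive] [F.Linear k]
  {R : D ⥤ C} (adj : F ⊣ R)

/-- The functional on `Hom(𝟙, F X)` corresponding to a morphism `X ⟶ R 𝟙`. -/
noncomputable def homRightAdjointDual (X : C) :
    (X ⟶ R.obj (𝟙_ D)) →ₗ[k] Module.Dual k (𝟙_ D ⟶ F.obj X) :=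
  homUnitDual k (F.obj X) ∘ₗ CategoryTheory.Linear.rightComp k _ (counitUnit adj) ∘ₗ
    F.mapLinearMap k

lemma homRightAdjointDual_apply {X : C} (g : X ⟶ R.obj (𝟙_ D)) (v : 𝟙_ D ⟶ F.obj X) :
    homRightAdjointDual k adj X g v = unitScalar k (v ≫ F.map g ≫ counitUnit adj) := rfl

lemma bijective_homRightAdjointDual {X : C} (hX : IsTrivial (F.obj X)) :
    Function.Bijective (homRightAdjointDual k adj X) := by
  refine (hX.bijective_homUnitDual k).comp ⟨fun g h w => hom_ext_counitUnit adj w, fun u => ?_⟩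
  exact ⟨adj.homEquiv _ _ u, map_homEquiv_counitUnit adj u⟩

/-- The morphism `X ⟶ R 𝟙` given by a functional on `Hom(𝟙, F X)`, for `F X` trivial. -/
noncomputable def matrixCoeff {X : C} (hX : IsTrivial (F.obj X)) :
    Module.Dual k (𝟙_ D ⟶ F.obj X) →ₗ[k] (X ⟶ R.obj (𝟙_ D)) :=
  (LinearEquiv.ofBijective _ (bijective_homRightAdjointDual k adj hX)).symm.toLinearMap

lemma homRightAdjointDual_matrixCoeff {X : C} (hX : IsTrivial (F.obj X))
    (φ : Module.Dual k (𝟙_ D ⟶ F.obj X)) :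
    homRightAdjointDual k adj X (matrixCoeff k adj hX φ) = φ :=
  (LinearEquiv.ofBijective _ (bijective_homRightAdjointDual k adj hX)).apply_symm_apply φ

lemma unitScalar_matrixCoeff {X : C} (hX : IsTrivial (F.obj X))
    (φ : Module.Dual k (𝟙_ D ⟶ F.obj X)) (v : 𝟙_ D ⟶ F.obj X) :
    unitScalar k (v ≫ F.map (matrixCoeff k adj hX φ) ≫ counitUnit adj) = φ v :=
  LinearMap.congr_fun (homRightAdjointDual_matrixCoeff k adj hX φ) v

/-- Naturality of matrix coefficients in the object; it supplies the dinaturality needed to descend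
to the coend. -/
lemma comp_matrixCoeff {X Y : C} (hX : IsTrivial (F.obj X)) (hY : IsTrivial (F.obj Y))
    (g : X ⟶ Y) (φ : Module.Dual k (𝟙_ D ⟶ F.obj Y)) :
    matrixCoeff k adj hX (φ ∘ₗ CategoryTheory.Linear.rightComp k _ (F.map g)) =
      g ≫ matrixCoeff k adj hY φ := by
  apply (bijective_homRightAdjointDual k adj hX).1
  rw [homRightAdjointDual_matrixCoeff]
  ext v
  have h := unitScalar_matrixCoeff k adj hY φ (v ≫ F.map g)
  rw [homRightAdjointDual_apply, Functor.map_comp, Category.assoc, ← Category.assoc, h]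
  rfl

/-- The element `v ≫ F g_φ` of `Hom(𝟙, F (R 𝟙))`, with `g_φ` the matrix coefficient of `φ`. -/
noncomputable def matrixElem {X : C} (hX : IsTrivial (F.obj X)) :
    (Module.Dual k (𝟙_ D ⟶ F.obj X) ⊗[k] (𝟙_ D ⟶ F.obj X)) →ₗ[k]
      (𝟙_ D ⟶ F.obj (R.obj (𝟙_ D))) :=
  TensorProduct.lift <| LinearMap.mk₂ k (fun φ v => v ≫ F.map (matrixCoeff k adj hX φ))
    (by intros; simp) (by intros; simp [F.map_smul]) (by intros; simp) (by intros; simp)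

variable {C' : Type u₃} [Category.{v₃} C'] {f : C' ⥤ C}

/-- The map from the coend of `Hom(𝟙, F f -)` to `Hom(𝟙, F (R 𝟙))` given by matrix
coefficients. -/
noncomputable def coendToFiber (hf : ∀ X, IsTrivial (F.obj (f.obj X))) :
    Coend k (f ⋙ F) →ₗ[k] (𝟙_ D ⟶ F.obj (R.obj (𝟙_ D))) :=
  coendLift k (Φ := f ⋙ F) (fun X => matrixElem k adj (hf X)) fun X Y g φ v => by
    have h := comp_matrixCoeff k adj (hf X) (hf Y) (f.map g) φ
    refine (congrArg (fun t => v ≫ F.map t) h).trans ?_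
    rw [Functor.map_comp, ← Category.assoc]
    rfl

lemma coendToFiber_coendIn (hf : ∀ X, IsTrivial (F.obj (f.obj X))) {X : C'}
    (φ : Module.Dual k (𝟙_ D ⟶ F.obj (f.obj X))) (v : 𝟙_ D ⟶ F.obj (f.obj X)) :
    coendToFiber k adj hf (coendIn k (f ⋙ F) X (φ ⊗ₜ v)) =
      v ≫ F.map (matrixCoeff k adj (hf X) φ) :=
  coendLift_coendIn k (Φ := f ⋙ F) _ _ X _

/-- Co-Yoneda: an object `B` with `f B ≅ R 𝟙` represents `X ↦ ω(X)^*`, so every class in the coend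
can be moved to `B` with one universal functional. -/
lemma bijective_coendToFiber [f.Full] (hf : ∀ X, IsTrivial (F.obj (f.obj X)))
    (hA : f.essImage (R.obj (𝟙_ D))) : Function.Bijective (coendToFiber k adj hf) := by
  obtain ⟨B, ⟨e⟩⟩ := hA
  -- The universal functional: its matrix coefficient is `e.hom` itself.
  let φ₀ : Module.Dual k (𝟙_ D ⟶ F.obj (f.obj B)) := homRightAdjointDual k adj _ e.hom
  have hφ₀ : matrixCoeff k adj (hf B) φ₀ = e.hom :=
    (bijective_homRightAdjointDual k adj (hf B)).1 (homRightAdjointDual_matrixCoeff k adj _ _)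
  let inv : (𝟙_ D ⟶ F.obj (R.obj (𝟙_ D))) →ₗ[k] Coend k (f ⋙ F) :=
    coendIn k (f ⋙ F) B ∘ₗ TensorProduct.mk k _ _ φ₀ ∘ₗ
      CategoryTheory.Linear.rightComp k (𝟙_ D) (F.map e.inv)
  have hinv (w) : inv w = coendIn k (f ⋙ F) B (φ₀ ⊗ₜ (w ≫ F.map e.inv)) := rfl
  refine Function.bijective_iff_has_inverse.2 ⟨inv, fun z => ?_, fun w => ?_⟩
  · suffices h : inv ∘ₗ coendToFiber k adj hf = LinearMap.id from LinearMap.congr_fun h z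
    refine coend_hom_ext fun X φ v => ?_
    -- Fullness lifts the matrix coefficient of `φ` to `g : X ⟶ B`. Then `φ = φ₀ ∘ ω(g)`, and
    -- dinaturality gives `[φ ⊗ v] = [φ₀ ⊗ ω(g) v]`.
    obtain ⟨g, hg⟩ := f.map_surjective (matrixCoeff k adj (hf X) φ ≫ e.inv)
    rw [LinearMap.comp_apply, coendToFiber_coendIn, hinv, Category.assoc, ← Functor.map_comp, ← hg]
    refine (coendIn_dinatural g φ₀ v).symm.trans ?_
    refine congrArg (fun ψ => coendIn k (f ⋙ F) X (ψ ⊗ₜ v)) ?_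
    rw [← homRightAdjointDual_matrixCoeff k adj (hf X) φ]
    ext v
    change homRightAdjointDual k adj _ e.hom (v ≫ F.map (f.map g)) = _
    rw [homRightAdjointDual_apply, homRightAdjointDual_apply, hg]
    simp [← Functor.map_comp_assoc]
  · rw [hinv, coendToFiber_coendIn, hφ₀]
    simp [← Functor.map_comp]

variable [MonoidalCategory C] [F.Monoidal] [MonoidalCategory C'] [f.Monoidal]

/-- `fiberMul` as a bilinear map. -/
noncomputable def fiberMulLinear : (𝟙_ D ⟶ F.obj (R.obj (𝟙_ D))) →ₗ[k]
    (𝟙_ D ⟶ F.obj (R.obj (𝟙_ D))) →ₗ[k] (𝟙_ D ⟶ F.obj (R.obj (𝟙_ D))) :=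
  LinearMap.mk₂ k (fiberMul adj)
    (by intros; simp [fiberMul, fiberPair, MonoidalPreadditive.add_tensor])
    (by intros; simp [fiberMul, fiberPair, MonoidalCategory.tensorHom_def])
    (by intros; simp [fiberMul, fiberPair, MonoidalPreadditive.tensor_add])
    (by intros; simp [fiberMul, fiberPair, MonoidalCategory.tensorHom_def])

/-- Both sides induce functionals on `ω(X ⊗ Y)`, which is spanned by pairs; on `v ⊗ w` each gives `φ
v * ψ w` because the counit is multiplicative. -/
lemma matrixCoeff_dualTensor [HasStrongFiber k (f ⋙ F)] (hf : ∀ X, IsTrivial (F.obj (f.obj X)))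
    {X Y : C'} (φ : Module.Dual k (𝟙_ D ⟶ F.obj (f.obj X)))
    (ψ : Module.Dual k (𝟙_ D ⟶ F.obj (f.obj Y))) :
    matrixCoeff k adj (hf (X ⊗ Y)) (dualTensor k (f ⋙ F) X Y (φ ⊗ₜ ψ)) =
      δ f X Y ≫ (matrixCoeff k adj (hf X) φ ⊗ₘ matrixCoeff k adj (hf Y) ψ) ≫
        (rightAdjointMonObj adj).mul := by
  apply (bijective_homRightAdjointDual k adj (hf (X ⊗ Y))).1
  rw [homRightAdjointDual_matrixCoeff]
  refine fiber_dual_ext (Φ := f ⋙ F) fun v w => ?_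
  rw [dualTensor_apply]
  refine Eq.trans ?_ (congrArg _ (fiberTensor_tmul_comp k v w).symm)
  rw [homRightAdjointDual_apply, Category.assoc, ← Functor.map_comp_assoc, μ_δ_assoc,
    fiberPair_map_mul_counitUnit, ← unitScalar_smul_comp k, map_smul]
  exact congrArg₂ (· * ·) (unitScalar_matrixCoeff k adj (hf X) φ v).symm
    (unitScalar_matrixCoeff k adj (hf Y) ψ w).symm

/-- By bilinearity it suffices to multiply generators, where the claim is the multiplicativity of
matrix coefficients. -/
lemma coendToFiber_mul [HasStrongFiber k (f ⋙ F)] (hf : ∀ X, IsTrivial (F.obj (f.obj X)))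
    (a b : Coend k (f ⋙ F)) : coendToFiber k adj hf (coendMul k (f ⋙ F) a b) =
      fiberMul adj (coendToFiber k adj hf a) (coendToFiber k adj hf b) := by
  let M := fiberMulLinear k adj
  let Θ := coendToFiber k adj hf
  suffices h : Θ ∘ₗ coendMul k (f ⋙ F) a = M (Θ a) ∘ₗ Θ from LinearMap.congr_fun h b
  refine coend_hom_ext fun Y ψ w => ?_
  suffices h : Θ ∘ₗ (coendMul k (f ⋙ F)).flip (coendIn k (f ⋙ F) Y (ψ ⊗ₜ w)) =
    M.flip (Θ (coendIn k (f ⋙ F) Y (ψ ⊗ₜ w))) ∘ₗ Θ from LinearMap.congr_fun h a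
  refine coend_hom_ext fun X φ v => ?_
  simp only [LinearMap.comp_apply, LinearMap.flip_apply]
  rw [coendMul_apply]
  refine (coendToFiber_coendIn k adj hf _ _).trans ?_
  refine Eq.trans ?_ (congrArg₂ (fiberMul adj) (coendToFiber_coendIn k adj hf φ v)
    (coendToFiber_coendIn k adj hf ψ w)).symm
  rw [matrixCoeff_dualTensor, fiberTensor_tmul_comp,
    Category.assoc, ← Functor.map_comp, μ_δ_assoc, MonoidalCategory.tensorHom_def, fiberMul,
    Functor.map_comp, Functor.map_comp]
  simp only [← Category.assoc, fiberPair_whiskerRight, fiberPair_whiskerLeft]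

end MatrixCoefficient

/-- The braiding of the central algebra with itself has `σ` at `R 𝟙` as underlying morphism, and
morphisms in the center are determined by their underlying morphisms. -/
lemma isSymmetricObject_inducedCentralAlgebra_iff {C : Type u₁} [Category.{v₁} C]
    [MonoidalCategory C] [RigidCategory C] {D : Type u₂} [Category.{v₂} D] [MonoidalCategory D]
    {F : C ⥤ D} [F.Monoidal] {R : D ⥤ C} (adj : F ⊣ R) :
    IsSymmetricObject (inducedCentralAlgebra adj) ↔
      (sigma adj (R.obj (𝟙_ D))).hom ≫ (sigma adj (R.obj (𝟙_ D))).hom = 𝟙 _ :=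
  ⟨fun h => congrArg Center.Hom.f h, fun h => Center.ext _ _ h⟩

end TensorCat

/-! ### The three equivalent conditions -/

theorem mainTheorem8 {k : Type w} [Field k] [IsAlgClosed k] [CharZero k]
    {C' : Type u₁} [Category.{v₁} C'] [Abelian C'] [CategoryTheory.Linear k C']
    [MonoidalCategory C'] [RigidCategory C'] [TensorCat.IsTensorCategory k C']
    {C : Type u₂} [Category.{v₂} C] [Abelian C] [CategoryTheory.Linear k C]
    [MonoidalCategory C] [RigidCategory C] [TensorCat.IsTensorCategory k C]
    {C'' : Type u₃} [Category.{v₃} C''] [Abelian C''] [CategoryTheory.Linear k C'']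
    [MonoidalCategory C''] [RigidCategory C''] [TensorCat.IsTensorCategory k C'']
    (f : C' ⥤ C) [f.Monoidal] [TensorCat.IsTensorFunctor k f]
    (F : C ⥤ C'') [F.Monoidal] [TensorCat.IsTensorFunctor k F]
    (hE : TensorCat.IsExactSequence f F)
    (R : C'' ⥤ C) (adj : F ⊣ R) [PreservesFiniteLimits R] [PreservesFiniteColimits R] :
    List.TFAE [
      TensorCat.IsSymmetricObject (TensorCat.inducedCentralAlgebra adj),
      (TensorCat.freeRightModule (TensorCat.inducedCentralAlgebra adj)
        (TensorCat.inducedCentralAlgebra adj)).IsDyslectic,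
      hE.IsAbelian k] := by
  have : F.Additive := TensorCat.IsTensorFunctor.additive k
  have : F.Linear k := TensorCat.IsTensorFunctor.linear
  have : MonoidalPreadditive C'' := TensorCat.IsTensorCategory.toMonoidalPreadditive k
  have := hE.full
  have := TensorCat.hasStrongFiber k (f ⋙ F) hE.isTrivial_obj
  have hA := TensorCat.isTrivial_map_rightAdjoint_unit adj k hE.normal
  -- Triviality of `F (R 𝟙)` places `R 𝟙` in the essential image of `f` by exactness.
  have hΘ := TensorCat.bijective_coendToFiber k adj hE.isTrivial_obj ((hE.essImage_iff _).2 hA)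
  have hmul := TensorCat.coendToFiber_mul k adj hE.isTrivial_obj
  rw [TensorCat.isSymmetricObject_inducedCentralAlgebra_iff]
  tfae_have 1 → 2 := fun h => TensorCat.freeRightModule_isDyslectic_of_isSymmetricObject
    ((TensorCat.isSymmetricObject_inducedCentralAlgebra_iff adj).2 h)
  tfae_have 2 → 1 := fun h => (TensorCat.isSymmetricObject_inducedCentralAlgebra_iff adj).1
    (TensorCat.isSymmetricObject_of_freeRightModule_isDyslectic h)
  tfae_have 1 → 3 := fun h => by
    -- The coend embeds in a Hom space of `C''`, which is finite dimensional.
    refine ⟨Module.Finite.of_injective (TensorCat.coendToFiber k adj hE.isTrivial_obj) hΘ.1,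
      fun x y => hΘ.1 ?_⟩
    refine (hmul x y).trans (Eq.trans ?_ (hmul y x).symm)
    exact TensorCat.fiberMul_comm_of_sigma_sigma adj hA h _ _
  tfae_have 3 → 1 := fun h => by
    refine TensorCat.sigma_sigma_of_comm adj hA fun v w => ?_
    obtain ⟨x, rfl⟩ := hΘ.2 v
    obtain ⟨y, rfl⟩ := hΘ.2 w
    rw [← hmul, ← hmul]
    exact congrArg _ (h.2 x y)
  tfae_finish
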